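/- Let $N\ge 1$ and let $M\subset\mathbb{CP}^N$ be an embedded real hypersurface of class $C^2$ (compact or not), with CR distribution $D_x=T_xM\cap JT_xM$. Let $\nu\colon M\to\mathbb{CP}^{N*}$ be the dual map, which sends $x$ to the complex projective hyperplane through $x$ whose tangent space at $x$ is $D_x$, and let $M^*=\nu(M)$. Assume that $M$ has immersed dual set, that is, that $\nu$ is an immersion (equivalently, a local embedding). Let $L=\{\lambda H_0+\mu H_1\}\subset\mathbb{CP}^{N*}$ be a pencil of hyperplanes (a projective line), with base locus $\mathcal B=H_0\cap H_1$, let $\Phi=[H_0:H_1]\colon\mathbb{CP}^N\setminus\mathcal B\to\mathbb{CP}^1$, and let $\phi$ be the restriction of $\Phi$ to $M\setminus\mathcal B$. One says that $L$ is a *Lefschetz pencil* for $M$ if $L$ is transverse to all branches of $M^*$: for every $x\in M$ with $\nu(x)\in L$, $T_{\nu(x)}L+d\nu(T_xM)=T_{\nu(x)}\mathbb{CP}^{N*}$. One says that $L$ *defines a (degree one) Lefschetz pencil structure* on $M$ if any two distinct hyperplanes of $L$ intersect transversally, in $\mathcal B$, and 1. $\mathcal B$ is transverse to $M$; 2. on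 $M\setminus\mathcal B$, the CR one-jet $(\phi,d\phi|_D)$, a section of the bundle with fibre $\{(y,h): y\in\mathbb{CP}^1,\ h\in\mathrm{Hom}_{\mathbb C}(D_x,T_y\mathbb{CP}^1)\}$, is transversal along $D$ to $\Sigma=\{h=0\}$; 3. along $M\setminus\mathcal B$, the one-jet $(\Phi,d\Phi)$, a section of the bundle with fibre $\{(y,h): y\in\mathbb{CP}^1,\ h\in\mathrm{Hom}_{\mathbb C}(T_x\mathbb{CP}^N,T_y\mathbb{CP}^1)\}$, is transversal along $M$ to $\{h=0\}$. (Here $T_x\mathbb{CP}^N$ is the smallest complex subspace containing $T_xM$. A section $\sigma$ of a bundle $E$ is transversal to $S\subset E$ along a distribution $A$ on the base if, at each point $x$ considered with $\sigma(x)\in S$, the preimage $\hat A\subset T_{\sigma(x)}E$ of $A_x$ is spanned by its intersections with $T_{\sigma(x)}S$ and with the tangent space of the graph of $\sigma$; transversal along $M$ means along $A=TM$.) Then $L$ is a Lefschetz pencil for $M$ if and only if its base locus $\mathcal B$ intersects $M$ transversely. Moreover, $L$ defines a Lefschetz pencil structure on $M$ if and only if this is the case; in particular, every Lefschetz pencil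 for $M$ defines a Lefschetz pencil structure. -/

import Mathlib

open scoped Manifold ContDiff LinearAlgebra.Projectivization Matrix Topology

noncomputable section

/-- Complex projective space `ℂℙᴺ`. -/
abbrev CP (N : ℕ) : Type := ℙ ℂ (Fin (N + 1) → ℂ)

namespace CP

/-- The quotient topology. -/
instance instTopology (N : ℕ) : TopologicalSpace (CP N) :=
  TopologicalSpace.coinduced (Projectivization.mk' ℂ) inferInstance

/-- The projection `v ↦ [v]`, with a junk value at `v = 0`. -/
def proj {N : ℕ} (v : Fin (N + 1) → ℂ) : CP N :=
  open Classical in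
  if h : v = 0 then Classical.arbitrary (CP N) else Projectivization.mk ℂ v h

theorem proj_of_ne {N : ℕ} {v : Fin (N + 1) → ℂ} (h : v ≠ 0) :
    proj v = Projectivization.mk ℂ v h := by simp [proj, h]

theorem proj_rep {N : ℕ} (p : CP N) : proj p.rep = p := by
  rw [proj_of_ne p.rep_nonzero, Projectivization.mk_rep]

/-- The affine coordinates `z_k / z_i`, `k ≠ i`. -/
def affCoord {N : ℕ} (i : Fin (N + 1)) (p : CP N) : Fin N → ℂ :=
  fun k => p.rep (i.succAbove k) / p.rep i

theorem rep_mk {N : ℕ} (v : Fin (N + 1) → ℂ) (hv : v ≠ 0) :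
    ∃ c : ℂ, c ≠ 0 ∧ (Projectivization.mk ℂ v hv).rep = c • v := by
  obtain ⟨a, ha⟩ := Projectivization.exists_smul_eq_mk_rep ℂ v hv
  exact ⟨a, a.ne_zero, ha.symm⟩

theorem rep_mk_ne_zero_iff {N : ℕ} (v : Fin (N + 1) → ℂ) (hv : v ≠ 0) (i : Fin (N + 1)) :
    (Projectivization.mk ℂ v hv).rep i ≠ 0 ↔ v i ≠ 0 := by
  obtain ⟨c, hc, h⟩ := rep_mk v hv
  simp [h, hc]

theorem affCoord_mk {N : ℕ} (i : Fin (N + 1)) (v : Fin (N + 1) → ℂ) (hv : v ≠ 0) :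
    affCoord i (Projectivization.mk ℂ v hv) = fun k => v (i.succAbove k) / v i := by
  obtain ⟨c, hc, h⟩ := rep_mk v hv
  funext k
  simp [affCoord, h, mul_div_mul_left _ _ hc]

theorem insertNth_ne_zero {N : ℕ} (i : Fin (N + 1)) (w : Fin N → ℂ) :
    (i.insertNth (1 : ℂ) w : Fin (N + 1) → ℂ) ≠ 0 := fun h => by
  simpa using congrFun h i

theorem continuous_mk' (N : ℕ) :
    Continuous (Projectivization.mk' ℂ : {v : Fin (N + 1) → ℂ // v ≠ 0} → CP N) :=
  continuous_coinduced_rng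

theorem isOpen_iff {N : ℕ} (s : Set (CP N)) :
    IsOpen s ↔ IsOpen ((Projectivization.mk' ℂ :
      {v : Fin (N + 1) → ℂ // v ≠ 0} → CP N) ⁻¹' s) := isOpen_coinduced

theorem isOpen_source {N : ℕ} (i : Fin (N + 1)) : IsOpen {p : CP N | p.rep i ≠ 0} := by
  rw [isOpen_iff]
  have : ((Projectivization.mk' ℂ : {v : Fin (N + 1) → ℂ // v ≠ 0} → CP N) ⁻¹'
      {p : CP N | p.rep i ≠ 0}) = {v | v.1 i ≠ 0} := by
    ext v
    simp only [Set.mem_preimage, Projectivization.mk'_eq_mk, Set.mem_ofPred_eq]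
    exact rep_mk_ne_zero_iff v.1 v.2 i
  rw [this]
  exact isOpen_ne_fun ((continuous_apply i).comp continuous_subtype_val) continuous_const

/-- The standard affine chart `{z_i ≠ 0} → ℂᴺ`. -/
def affChart {N : ℕ} (i : Fin (N + 1)) : OpenPartialHomeomorph (CP N) (Fin N → ℂ) where
  toFun := affCoord i
  invFun w := Projectivization.mk ℂ (i.insertNth (1 : ℂ) w) (insertNth_ne_zero i w)
  source := {p | p.rep i ≠ 0}
  target := Set.univ
  map_source' _ _ := Set.mem_univ _
  map_target' w _ := by
    simp only [Set.mem_ofPred_eq]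
    rw [rep_mk_ne_zero_iff]
    simp
  left_inv' p hp := by
    induction p using Projectivization.ind with
    | h v hv =>
      have hvi : v i ≠ 0 := (rep_mk_ne_zero_iff v hv i).1 hp
      rw [affCoord_mk, Projectivization.mk_eq_mk_iff']
      refine ⟨(v i)⁻¹, ?_⟩
      funext k
      refine Fin.succAboveCases i ?_ (fun k => ?_) k
      · simp [hvi]
      · simp [div_eq_inv_mul]
  right_inv' w _ := by
    rw [affCoord_mk]
    simp
  open_source := isOpen_source i
  open_target := isOpen_univ
  continuousOn_toFun := by
    rw [continuousOn_open_iff (isOpen_source i)]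
    intro t ht
    rw [isOpen_iff]
    have hc : ContinuousOn (fun v : {v : Fin (N + 1) → ℂ // v ≠ 0} =>
        (fun k => v.1 (i.succAbove k) / v.1 i : Fin N → ℂ)) {v | v.1 i ≠ 0} := by
      refine continuousOn_pi.2 fun k => ContinuousOn.div ?_ ?_ (fun v hv => hv)
      · exact ((continuous_apply (i.succAbove k)).comp continuous_subtype_val).continuousOn
      · exact ((continuous_apply i).comp continuous_subtype_val).continuousOn
    have ho : IsOpen {v : {v : Fin (N + 1) → ℂ // v ≠ 0} | v.1 i ≠ 0} :=
      isOpen_ne_fun ((continuous_apply i).comp continuous_subtype_val) continuous_const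
    convert (continuousOn_open_iff ho).1 hc t ht using 1
    ext v
    simp only [Set.mem_preimage, Set.mem_inter_iff, Projectivization.mk'_eq_mk, Set.mem_ofPred_eq]
    rw [rep_mk_ne_zero_iff, affCoord_mk]
  continuousOn_invFun := by
    refine Continuous.continuousOn ?_
    have : Continuous (fun w : Fin N → ℂ =>
        (⟨i.insertNth (1 : ℂ) w, insertNth_ne_zero i w⟩ : {v : Fin (N + 1) → ℂ // v ≠ 0})) :=
      Continuous.subtype_mk (Continuous.finInsertNth (A := fun _ => ℂ) i continuous_const continuous_id) _
    exact (continuous_mk' N).comp this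

theorem exists_rep_ne_zero {N : ℕ} (p : CP N) : ∃ i, p.rep i ≠ 0 :=
  Function.ne_iff.1 p.rep_nonzero

/-- The atlas of the standard affine charts. -/
instance instChartedSpace (N : ℕ) : ChartedSpace (Fin N → ℂ) (CP N) where
  atlas := Set.range affChart
  chartAt p := affChart (exists_rep_ne_zero p).choose
  mem_chart_source p := (exists_rep_ne_zero p).choose_spec
  chart_mem_atlas _ := Set.mem_range_self _

theorem contDiffOn_transition {N : ℕ} (i i' : Fin (N + 1)) :
    ContDiffOn ℂ ω ((affChart i).symm.trans (affChart i'))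
      ((affChart i).symm.trans (affChart i')).source := by
  have hins : ∀ k, ContDiff ℂ ω fun w : Fin N → ℂ => (i.insertNth (1 : ℂ) w : Fin (N + 1) → ℂ) k := by
    intro k
    refine Fin.succAboveCases i ?_ (fun k => ?_) k
    · simpa using contDiff_const
    · simpa using contDiff_apply ℂ ℂ k
  have heq : ∀ w, ((affChart i).symm.trans (affChart i')) w = fun k =>
      (i.insertNth (1 : ℂ) w : Fin (N + 1) → ℂ) (i'.succAbove k) /
        (i.insertNth (1 : ℂ) w : Fin (N + 1) → ℂ) i' := fun w => affCoord_mk _ _ _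
  refine ContDiffOn.congr ?_ (fun w _ => heq w)
  refine contDiffOn_pi.2 fun k => ContDiffOn.div (hins _).contDiffOn (hins _).contDiffOn ?_
  rintro w ⟨-, hw⟩
  exact (rep_mk_ne_zero_iff _ _ _).1 hw

instance instIsManifoldComplex (N : ℕ) : IsManifold 𝓘(ℂ, Fin N → ℂ) ω (CP N) := by
  refine isManifold_of_contDiffOn _ _ _ ?_
  rintro _ _ ⟨i, rfl⟩ ⟨i', rfl⟩
  simpa using contDiffOn_transition i i'

instance instIsManifoldReal (N : ℕ) : IsManifold 𝓘(ℝ, Fin N → ℂ) ω (CP N) := by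
  refine isManifold_of_contDiffOn _ _ _ ?_
  rintro _ _ ⟨i, rfl⟩ ⟨i', rfl⟩
  simpa using (contDiffOn_transition i i').restrict_scalars ℝ


/-- The differential of `v ↦ [v]` at `z`, a map `ℂᴺ⁺¹ → T_{[z]}ℂℙᴺ`. The tangent spaces of `ℂℙᴺ` are
Mathlib's, that is, copies of `ℂᴺ`; as the charts are holomorphic, multiplication by `i` on `ℂᴺ` is
the complex structure `J`. -/
def dproj {N : ℕ} (z : Fin (N + 1) → ℂ) : (Fin (N + 1) → ℂ) →L[ℂ] (Fin N → ℂ) :=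
  mfderiv 𝓘(ℂ, Fin (N + 1) → ℂ) 𝓘(ℂ, Fin N → ℂ) (proj : (Fin (N + 1) → ℂ) → CP N) z

theorem continuousAt_proj {N : ℕ} {z : Fin (N + 1) → ℂ} (hz : z ≠ 0) :
    ContinuousAt (proj : (Fin (N + 1) → ℂ) → CP N) z := by
  have ho : IsOpen {v : Fin (N + 1) → ℂ | v ≠ 0} := isOpen_ne
  have : ContinuousOn (proj : (Fin (N + 1) → ℂ) → CP N) {v | v ≠ 0} := by
    rw [continuousOn_iff_continuous_domRestrict]
    exact (continuous_mk' N).congr fun v => (proj_of_ne v.2).symm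
  exact this.continuousAt (ho.mem_nhds hz)

/-- The differential of `v ↦ [v]` is given by the quotient rule in an affine chart. -/
theorem exists_dproj_eq {N : ℕ} {z : Fin (N + 1) → ℂ} (hz : z ≠ 0) :
    ∃ i, z i ≠ 0 ∧ ∀ v k, dproj z v k =
      (v (i.succAbove k) * z i - z (i.succAbove k) * v i) / z i ^ 2 := by
  set p := (proj z : CP N) with hp
  have hpz : p = Projectivization.mk ℂ z hz := proj_of_ne hz
  set i := (exists_rep_ne_zero p).choose with hi
  have hzi : z i ≠ 0 := by
    have := (exists_rep_ne_zero p).choose_spec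
    rw [← hi, hpz] at this
    exact (rep_mk_ne_zero_iff z hz i).1 this
  refine ⟨i, hzi, ?_⟩
  let D : (Fin (N + 1) → ℂ) →L[ℂ] (Fin N → ℂ) := ContinuousLinearMap.pi fun k =>
    (z i ^ 2)⁻¹ • (z i • ContinuousLinearMap.proj (R := ℂ) (φ := fun _ => ℂ) (i.succAbove k) -
      z (i.succAbove k) • ContinuousLinearMap.proj (R := ℂ) (φ := fun _ => ℂ) i)
  have hD : HasFDerivAt (fun v : Fin (N + 1) → ℂ => (fun k => v (i.succAbove k) / v i : Fin N → ℂ))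
      D z := by
    refine hasFDerivAt_pi.2 fun k => ?_
    have h1 : HasFDerivAt (fun v : Fin (N + 1) → ℂ => v (i.succAbove k))
      (ContinuousLinearMap.proj (R := ℂ) (φ := fun _ => ℂ) (i.succAbove k)) z := hasFDerivAt_apply _ _
    have h2 : HasFDerivAt (fun v : Fin (N + 1) → ℂ => v i)
      (ContinuousLinearMap.proj (R := ℂ) (φ := fun _ => ℂ) i) z := hasFDerivAt_apply _ _
    have h3 := h1.mul ((hasDerivAt_inv hzi).comp_hasFDerivAt z h2)
    refine (h3.congr_fderiv ?_).congr_of_eventuallyEq (.of_forall fun v => div_eq_mul_inv _ _)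
    ext v
    simp
    field_simp
    ring
  have hM : HasMFDerivAt 𝓘(ℂ, Fin (N + 1) → ℂ) 𝓘(ℂ, Fin N → ℂ)
      (proj : (Fin (N + 1) → ℂ) → CP N) z D := by
    refine ⟨continuousAt_proj hz, ?_⟩
    simp only [mfld_simps]
    refine HasFDerivAt.hasFDerivWithinAt (hD.congr_of_eventuallyEq ?_)
    filter_upwards [isOpen_ne.mem_nhds hz] with v hv
    have h : affCoord i (proj v) = fun k => v (i.succAbove k) / v i := by
      rw [proj_of_ne hv]
      exact affCoord_mk i v hv
    exact h
  intro v k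
  have h : dproj z = D := hM.mfderiv
  rw [h]
  simp [D]
  field_simp

/-- `T_{[z]}ℂℙᴺ = ℂᴺ⁺¹ / ℂz`. -/
theorem ker_dproj {N : ℕ} {z : Fin (N + 1) → ℂ} (hz : z ≠ 0) :
    LinearMap.ker (dproj z : (Fin (N + 1) → ℂ) →ₗ[ℂ] (Fin N → ℂ)) = Submodule.span ℂ {z} := by
  obtain ⟨i, hi, h⟩ := exists_dproj_eq hz
  ext v
  rw [LinearMap.mem_ker, Submodule.mem_span_singleton]
  constructor
  · intro hv
    refine ⟨v i / z i, ?_⟩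
    funext k
    refine Fin.succAboveCases i ?_ (fun k => ?_) k
    · simp [hi]
    · have := congrFun hv k
      rw [ContinuousLinearMap.coe_coe, h] at this
      simp only [Pi.zero_apply, div_eq_zero_iff, pow_eq_zero_iff, ne_eq, OfNat.ofNat_ne_zero,
        not_false_eq_true, hi, or_false] at this
      simp only [Pi.smul_apply, smul_eq_mul]
      field_simp
      linear_combination -this
  · rintro ⟨c, rfl⟩
    funext k
    rw [ContinuousLinearMap.coe_coe, h]
    simp
    left
    ring

theorem surjective_dproj {N : ℕ} {z : Fin (N + 1) → ℂ} (hz : z ≠ 0) :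
    Function.Surjective (dproj z) := by
  obtain ⟨i, hi, h⟩ := exists_dproj_eq hz
  intro w
  refine ⟨i.insertNth (0 : ℂ) (z i • w), ?_⟩
  funext k
  rw [h]
  simp
  field_simp

end CP

/-! ### Linear subspaces, duality, pencils -/

/-- The projective linear subspace `ℙ(W)` of `ℂℙᴺ`. -/
def linearSubspace {N : ℕ} (W : Submodule ℂ (Fin (N + 1) → ℂ)) : Set (CP N) :=
  {p | p.submodule ≤ W}

/-- `T_p ℙ(W) ⊆ T_p ℂℙᴺ`, for `p ∈ ℙ(W)`: the image of `W` under the differential of `v ↦ [v]`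
at a vector over `p`. -/
def tangentLinear {N : ℕ} (W : Submodule ℂ (Fin (N + 1) → ℂ)) (p : CP N) :
    Submodule ℂ (Fin N → ℂ) :=
  W.map (CP.dproj p.rep : (Fin (N + 1) → ℂ) →ₗ[ℂ] (Fin N → ℂ))

/-- The common zeros of the linear forms `z ↦ ∑ aᵢ zᵢ`, `a ∈ W`. -/
def annihilator {N : ℕ} (W : Submodule ℂ (Fin (N + 1) → ℂ)) : Submodule ℂ (Fin (N + 1) → ℂ) where
  carrier := {z | ∀ a ∈ W, a ⬝ᵥ z = 0}
  zero_mem' a _ := dotProduct_zero a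
  add_mem' hz hw a ha := by rw [dotProduct_add, hz a ha, hw a ha, add_zero]
  smul_mem' c z hz a ha := by rw [dotProduct_smul, hz a ha, smul_zero]

/-- The dual projective space `ℂℙᴺ*` of hyperplanes of `ℂℙᴺ`, in its homogeneous coordinates:
`[a]` stands for the hyperplane `∑ aᵢ zᵢ = 0`. -/
abbrev DualCP (N : ℕ) : Type := CP N

/-- The linear hyperplane of `ℂᴺ⁺¹` over the projective hyperplane `H ∈ ℂℙᴺ*`. -/
def hyperplane {N : ℕ} (H : DualCP N) : Submodule ℂ (Fin (N + 1) → ℂ) :=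
  annihilator H.submodule

theorem mem_hyperplane_mk {N : ℕ} {a : Fin (N + 1) → ℂ} (ha : a ≠ 0) (z : Fin (N + 1) → ℂ) :
    z ∈ hyperplane (Projectivization.mk ℂ a ha : DualCP N) ↔ a ⬝ᵥ z = 0 := by
  constructor
  · intro h
    refine h a ?_
    rw [Projectivization.submodule_mk]
    exact Submodule.mem_span_singleton_self a
  · intro h b hb
    rw [Projectivization.submodule_mk, Submodule.mem_span_singleton] at hb
    obtain ⟨c, rfl⟩ := hb
    rw [smul_dotProduct, h, smul_zero]

theorem hyperplane_injective {N : ℕ} :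
    Function.Injective (hyperplane : DualCP N → Submodule ℂ (Fin (N + 1) → ℂ)) := by
  intro H H' h
  induction H using Projectivization.ind with
  | h a ha =>
  induction H' using Projectivization.ind with
  | h b hb =>
  rw [Projectivization.mk_eq_mk_iff']
  have key : dotProductBilin ℂ ℂ a ∈
      Submodule.span ℂ (Set.range fun _ : Unit => dotProductBilin ℂ ℂ b) := by
    refine mem_span_of_iInf_ker_le_ker fun z hz => ?_
    simp only [Submodule.mem_iInf, LinearMap.mem_ker, dotProductBilin_apply_apply] at hz ⊢
    rw [← mem_hyperplane_mk ha, h, mem_hyperplane_mk hb]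
    exact hz ()
  rw [Set.range_const, Submodule.mem_span_singleton] at key
  obtain ⟨c, hc⟩ := key
  refine ⟨c, funext fun k => ?_⟩
  have := LinearMap.congr_fun hc (Pi.single k 1)
  simpa using this

/-- A hyperplane of `T_pℂℙᴺ` is the tangent space of exactly one projective hyperplane through
`p`. -/
theorem existsUnique_hyperplane {N : ℕ} (p : CP N) (D : Submodule ℂ (Fin N → ℂ))
    (hD : Module.finrank ℂ D + 1 = N) :
    ∃! H : DualCP N, p ∈ linearSubspace (hyperplane H) ∧ tangentLinear (hyperplane H) p = D := by
  set d := (CP.dproj p.rep : (Fin (N + 1) → ℂ) →ₗ[ℂ] (Fin N → ℂ)) with hd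
  have hsurj : Function.Surjective d := CP.surjective_dproj p.rep_nonzero
  have hker : LinearMap.ker d = p.submodule := by
    rw [Projectivization.submodule_eq]
    exact CP.ker_dproj p.rep_nonzero
  have hDtop : D ≠ ⊤ := by
    rintro rfl
    simp at hD
  refine existsUnique_of_exists_of_unique ?_ ?_
  · have hW : D.comap d < ⊤ := by
      refine lt_top_iff_ne_top.2 fun h => hDtop ?_
      rw [← Submodule.map_comap_eq_of_surjective hsurj D, h, Submodule.map_top,
        LinearMap.range_eq_top.2 hsurj]
    obtain ⟨f, hf, hle⟩ := Submodule.exists_le_ker_of_lt_top _ hW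
    have hfa : ∀ z, (fun i => f (Pi.single i 1)) ⬝ᵥ z = f z := fun z => by
      rw [LinearMap.pi_apply_eq_sum_univ f z]
      refine Finset.sum_congr rfl fun i _ => ?_
      rw [mul_comm, smul_eq_mul]
      refine congrArg (z i * ·) (congrArg f (funext fun k => ?_))
      simp [Pi.single_apply, eq_comm]
    have ha : (fun i => f (Pi.single i 1)) ≠ 0 := fun h => hf <| LinearMap.ext fun z => by
      rw [← hfa, h, zero_dotProduct, LinearMap.zero_apply]
    have hH : hyperplane (Projectivization.mk ℂ _ ha : DualCP N) = LinearMap.ker f := by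
      ext z
      rw [mem_hyperplane_mk, hfa, LinearMap.mem_ker]
    have hpf : LinearMap.ker d ≤ LinearMap.ker f := le_trans (fun z hz => by
      rw [Submodule.mem_comap, LinearMap.mem_ker.1 hz]; exact D.zero_mem) hle
    refine ⟨Projectivization.mk ℂ _ ha, ?_, ?_⟩
    · rw [linearSubspace, Set.mem_ofPred_eq, hH, ← hker]
      exact hpf
    · rw [tangentLinear, hH, ← hd]
      have h1 : D ≤ (LinearMap.ker f).map d := by
        rw [← Submodule.map_comap_eq_of_surjective hsurj D]
        exact Submodule.map_mono hle
      have h2 : (LinearMap.ker f).map d ≠ ⊤ := fun h => hf <| by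
        rw [← LinearMap.ker_eq_top, ← sup_eq_left.2 hpf, ← Submodule.comap_map_eq, h,
          Submodule.comap_top]
      have h3 := Submodule.finrank_lt h2
      rw [Module.finrank_fin_fun] at h3
      exact (Submodule.eq_of_le_of_finrank_le h1 (by omega)).symm
  · rintro H H' ⟨h1, h2⟩ ⟨h1', h2'⟩
    apply hyperplane_injective
    have h : ∀ W : Submodule ℂ (Fin (N + 1) → ℂ), p ∈ linearSubspace W →
        tangentLinear W p = D → W = D.comap d := fun W hp hW => by
      rw [← hW, tangentLinear, ← hd, Submodule.comap_map_eq, hker]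
      exact (sup_eq_left.2 hp).symm
    rw [h _ h1 h2, h _ h1' h2']

/-- A pencil of hyperplanes `λ H₀ + μ H₁` of `ℂℙᴺ`. -/
structure HyperplanePencil (N : ℕ) where
  /-- The two linear forms. -/
  form : Fin 2 → Fin (N + 1) → ℂ
  linearIndependent : LinearIndependent ℂ form

namespace HyperplanePencil

variable {N : ℕ} (L : HyperplanePencil N)

/-- The two-dimensional space of linear forms over the projective line `L ⊆ ℂℙᴺ*`. -/
def span : Submodule ℂ (Fin (N + 1) → ℂ) := Submodule.span ℂ (Set.range L.form)

/-- The pencil as a projective line of `ℂℙᴺ*`. -/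
def line : Set (DualCP N) := linearSubspace L.span

/-- The base locus `H₀ ∩ H₁`. -/
def baseLocus : Set (CP N) := linearSubspace (annihilator L.span)

/-- The map `Φ = [H₀ : H₁]` from the complement of the base locus to `ℂℙ¹` (with junk values on the
base locus). -/
def map (p : CP N) : CP 1 := CP.proj fun i => L.form i ⬝ᵥ p.rep

end HyperplanePencil

/-! ### Real hypersurfaces of `ℂℙⁿ⁺¹` -/

section Hypersurface

variable {n : ℕ} {M : Type*} [TopologicalSpace M]
  [ChartedSpace (EuclideanSpace ℝ (Fin (2 * n + 1))) M] (j : M → CP (n + 1))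

/-- The differential `T_pP → T_{f(p)}ℂℙᴺ` of a map into projective space, with the tangent spaces
written as their model spaces. -/
def dmap (E : Type*) [NormedAddCommGroup E] [NormedSpace ℝ E] {P : Type*} [TopologicalSpace P]
    [ChartedSpace E P] {N : ℕ} (f : P → CP N) (p : P) : E →L[ℝ] (Fin N → ℂ) :=
  mfderiv 𝓘(ℝ, E) 𝓘(ℝ, Fin N → ℂ) f p

/-- `j` is an embedding of class `C²`. -/
structure IsC2Embedding : Prop where
  contMDiff : ContMDiff (𝓡 (2 * n + 1)) 𝓘(ℝ, Fin (n + 1) → ℂ) 2 j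
  injective_dmap : ∀ x, Function.Injective (dmap (EuclideanSpace ℝ (Fin (2 * n + 1))) j x)
  isEmbedding : Topology.IsEmbedding j

/-- The tangent space `T_xM`, as a real subspace of `T_{j(x)}ℂℙⁿ⁺¹`. -/
def tangentM (x : M) : Submodule ℝ (Fin (n + 1) → ℂ) :=
  LinearMap.range (dmap (EuclideanSpace ℝ (Fin (2 * n + 1))) j x).toLinearMap

/-- The largest complex subspace `T ∩ J T` of a real subspace `T`. -/
def maxComplex {N : ℕ} (T : Submodule ℝ (Fin N → ℂ)) : Submodule ℂ (Fin N → ℂ) where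
  carrier := {v | v ∈ T ∧ Complex.I • v ∈ T}
  zero_mem' := by simp
  add_mem' hv hw := ⟨T.add_mem hv.1 hw.1, by rw [smul_add]; exact T.add_mem hv.2 hw.2⟩
  smul_mem' c v hv := by
    have key : ∀ a b : ℝ, ((a : ℂ) + b * Complex.I) • v ∈ T := fun a b => by
      rw [add_smul, mul_smul]
      exact T.add_mem (T.smul_mem a hv.1) (T.smul_mem b hv.2)
    refine ⟨?_, ?_⟩
    · simpa using key c.re c.im
    · have h : Complex.I * c = ((-c.im : ℝ) : ℂ) + (c.re : ℝ) * Complex.I := by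
        apply Complex.ext <;> simp
      rw [smul_smul, h]
      exact key _ _

theorem finrank_maxComplex {N : ℕ} (T : Submodule ℝ (Fin N → ℂ))
    (hT : Module.finrank ℝ T + 1 = 2 * N) : Module.finrank ℂ (maxComplex T) + 1 = N := by
  let J : (Fin N → ℂ) ≃ₗ[ℝ] (Fin N → ℂ) :=
    (LinearEquiv.smulOfUnit (M := Fin N → ℂ) (Units.mk0 Complex.I Complex.I_ne_zero)).restrictScalars ℝ
  have hJ : ∀ v, J v = Complex.I • v := fun v => rfl
  have hmax : (maxComplex T).restrictScalars ℝ = T ⊓ T.comap J.toLinearMap := by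
    ext v
    rfl
  have h1 : Module.finrank ℝ (T.comap J.toLinearMap : Submodule ℝ (Fin N → ℂ)) =
      Module.finrank ℝ T := by
    rw [Submodule.comap_equiv_eq_map_symm]
    exact LinearEquiv.finrank_map_eq _ _
  have h2 := Submodule.finrank_sup_add_finrank_inf_eq T (T.comap J.toLinearMap)
  have h3 : Module.finrank ℝ (maxComplex T) = 2 * Module.finrank ℂ (maxComplex T) :=
    finrank_real_of_complex _
  have h4 : Module.finrank ℝ ((maxComplex T).restrictScalars ℝ) =
      Module.finrank ℝ (maxComplex T) := rfl
  have h5 : Module.finrank ℝ (Fin N → ℂ) = 2 * N := by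
    rw [finrank_real_of_complex, Module.finrank_fin_fun]
  have h6 := Submodule.finrank_le (T ⊔ T.comap J.toLinearMap)
  have h7 := Submodule.finrank_mono (R := ℝ) (inf_le_left : T ⊓ T.comap J.toLinearMap ≤ T)
  rw [hmax] at h4
  omega

/-- The CR distribution `D_x = T_xM ∩ J T_xM`, as a complex subspace of `T_{j(x)}ℂℙⁿ⁺¹`. -/
def crTangent (x : M) : Submodule ℂ (Fin (n + 1) → ℂ) := maxComplex (tangentM j x)

/-- The CR distribution `D_x`, as a real subspace of `T_xM`. -/
def crDistribution (x : M) : Submodule ℝ (EuclideanSpace ℝ (Fin (2 * n + 1))) :=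
  ((crTangent j x).restrictScalars ℝ).comap
    (dmap (EuclideanSpace ℝ (Fin (2 * n + 1))) j x).toLinearMap

/-- `H` passes through `j(x)` and its tangent space there is `D_x`. -/
def IsCRTangentHyperplane (x : M) (H : DualCP (n + 1)) : Prop :=
  j x ∈ linearSubspace (hyperplane H) ∧ tangentLinear (hyperplane H) (j x) = crTangent j x

/-- The complex dual map `ν`: it sends `x` to the projective hyperplane tangent to `D_x`. -/
def dualMap (x : M) : DualCP (n + 1) := Classical.epsilon (IsCRTangentHyperplane j x)

theorem finrank_tangentM {j : M → CP (n + 1)} (hj : IsC2Embedding j) (x : M) :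
    Module.finrank ℝ (tangentM j x) + 1 = 2 * (n + 1) := by
  have := LinearMap.finrank_range_of_inj (f := (dmap (EuclideanSpace ℝ (Fin (2 * n + 1))) j x).toLinearMap)
    (hj.injective_dmap x)
  rw [finrank_euclideanSpace_fin] at this
  rw [tangentM, this]
  ring

/-- The dual map is well defined. -/
theorem existsUnique_crTangentHyperplane {j : M → CP (n + 1)} (hj : IsC2Embedding j) (x : M) :
    ∃! H, IsCRTangentHyperplane j x H :=
  existsUnique_hyperplane (j x) (crTangent j x) (finrank_maxComplex _ (finrank_tangentM hj x))

theorem isCRTangentHyperplane_dualMap {j : M → CP (n + 1)} (hj : IsC2Embedding j) (x : M) :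
    IsCRTangentHyperplane j x (dualMap j x) :=
  Classical.epsilon_spec (existsUnique_crTangentHyperplane hj x).exists

/-- `M` has immersed dual set: the dual map is an immersion, equivalently (it is of class `C¹`) a
local embedding. A map that is not differentiable at `x` has zero `dmap`, so that differentiability
is part of the condition. -/
def HasImmersedDualSet : Prop := ∀ x, Function.Injective (dmap (EuclideanSpace ℝ (Fin (2 * n + 1))) (dualMap j) x)

/-- The dual set `M*`. -/
def dualSet : Set (DualCP (n + 1)) := Set.range (dualMap j)

/-- The tangent space at `ν(x)` of the branch of `M*` that is the image of `M` near `x`. -/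
def tangentBranch (x : M) : Submodule ℝ (Fin (n + 1) → ℂ) :=
  LinearMap.range (dmap (EuclideanSpace ℝ (Fin (2 * n + 1))) (dualMap j) x).toLinearMap

/-- `L` is a Lefschetz pencil for `M`: at each point `H` of `L ∩ M*`, it is transverse to all the
branches of `M*` through `H`. -/
def IsLefschetzPencil (L : HyperplanePencil (n + 1)) : Prop :=
  ∀ H ∈ L.line ∩ dualSet j, ∀ x : M, dualMap j x = H →
    (tangentLinear L.span H).restrictScalars ℝ ⊔ tangentBranch j x = ⊤

/-- The base locus of the pencil intersects `M` transversely. -/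
def BaseLocusTransverse (L : HyperplanePencil (n + 1)) : Prop :=
  ∀ x : M, j x ∈ L.baseLocus →
    (tangentLinear (annihilator L.span) (j x)).restrictScalars ℝ ⊔ tangentM j x = ⊤

/-- The complex envelope `T_xM^J`: the smallest complex subspace containing `T_xM`. -/
def complexEnvelope (x : M) : Submodule ℂ (Fin (n + 1) → ℂ) :=
  Submodule.span ℂ (tangentM j x : Set (Fin (n + 1) → ℂ))

theorem complexEnvelope_eq_top {j : M → CP (n + 1)} (hj : IsC2Embedding j) (x : M) :
    complexEnvelope j x = ⊤ := by
  have hle : tangentM j x ≤ (complexEnvelope j x).restrictScalars ℝ := Submodule.subset_span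
  have h1 := Submodule.finrank_mono (R := ℝ) hle
  have h2 : Module.finrank ℝ ((complexEnvelope j x).restrictScalars ℝ) =
      2 * Module.finrank ℂ (complexEnvelope j x) := finrank_real_of_complex _
  have h3 := finrank_tangentM hj x
  refine Submodule.eq_top_of_finrank_eq ?_
  have h4 := Submodule.finrank_le (complexEnvelope j x)
  rw [Module.finrank_fin_fun] at h4 ⊢
  omega

/-! ### One-jets along a complex distribution -/

section Jets

variable {E : Type*} [NormedAddCommGroup E] [NormedSpace ℝ E] {P : Type*} [TopologicalSpace P]
  [ChartedSpace E P] [IsManifold 𝓘(ℝ, E) 1 P]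

/-- `e` is a `C¹` complex local frame near `p₀` of the distribution `Q`, where `Q` has the complex
structure that it inherits through `df` from `Tℂℙᴺ`. -/
def IsComplexFrameAt {N : ℕ} (f : P → CP N) (Q : P → Submodule ℝ E) (p₀ : P) {k : ℕ}
    (e : Fin k → P → E) : Prop :=
  (∀ i, ContMDiffAt 𝓘(ℝ, E) 𝓘(ℝ, E).tangent 1
    (fun p => (⟨p, e i p⟩ : TangentBundle 𝓘(ℝ, E) P)) p₀) ∧
  ∀ᶠ p in 𝓝 p₀, (∀ i, e i p ∈ Q p) ∧
    LinearIndependent ℂ (fun i => dmap E f p (e i p)) ∧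
    (Submodule.span ℂ (Set.range fun i => dmap E f p (e i p))).restrictScalars ℝ =
      (Q p).map (dmap E f p).toLinearMap

/-- A frame `e` of `Q` near `p₀` and the chart `χ` of `ℂℙ¹` at `ψ(p₀)` trivialize the bundle of jets
`{(y, h) | y ∈ ℂℙ¹, h ∈ Hom_ℂ(Q_p, T_yℂℙ¹)}` by `(p, y, h) ↦ (p, y, (dχ(h(eᵢ(p))))ᵢ)`. This is the
last component of the one-jet `(ψ, dψ|Q)` of `ψ` in that trivialization. -/
def jetComponent (ψ : P → CP 1) (p₀ : P) {k : ℕ} (e : Fin k → P → E) (p : P) : Fin k → Fin 1 → ℂ :=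
  fun i => mfderiv 𝓘(ℝ, E) 𝓘(ℝ, Fin 1 → ℂ)
    (fun q => extChartAt 𝓘(ℝ, Fin 1 → ℂ) (ψ p₀) (ψ q)) p (e i p)

/-- In the trivialization of the bundle of jets, the tangent space of its total space at the jet of
`ψ` at `p₀` is `T_{p₀}P × T_{ψ(p₀)}ℂℙ¹ × Hom_ℂ(Q_{p₀}, T_{ψ(p₀)}ℂℙ¹)`. -/
abbrev JetTangent (E : Type*) (k : ℕ) : Type _ := E × (Fin 1 → ℂ) × (Fin k → Fin 1 → ℂ)

/-- The preimage in the tangent space of the jet bundle of a subspace `A` of the tangent space of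
the base. -/
def liftDistribution (k : ℕ) (A : Submodule ℝ E) : Submodule ℝ (JetTangent E k) := A.prod ⊤

/-- The tangent space of `Σ = {h = 0}`. -/
def tangentSigma (E : Type*) [NormedAddCommGroup E] [NormedSpace ℝ E] (k : ℕ) :
    Submodule ℝ (JetTangent E k) :=
  Submodule.prod ⊤ (Submodule.prod ⊤ ⊥)

/-- The tangent space at `p₀` of the graph of the one-jet of `ψ`. -/
def tangentGraph (ψ : P → CP 1) (p₀ : P) {k : ℕ} (e : Fin k → P → E) :
    Submodule ℝ (JetTangent E k) :=
  LinearMap.range ((LinearMap.id : E →ₗ[ℝ] E).prod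
    ((dmap E ψ p₀).toLinearMap.prod
      (mfderiv 𝓘(ℝ, E) 𝓘(ℝ, Fin k → Fin 1 → ℂ) (jetComponent ψ p₀ e) p₀ :
        E →L[ℝ] (Fin k → Fin 1 → ℂ)).toLinearMap))

/-- The one-jet along `Q` of `ψ` is, at the point `p₀`, transversal to `Σ` along a distribution whose
value at `p₀` is `A`: if it meets `Σ` at `p₀`, then the lift of `A` is spanned by its intersections
with the tangent spaces of `Σ` and of the graph of the jet. (The choice of the frame is
immaterial.) -/
def JetTransverseAt {N : ℕ} (f : P → CP N) (Q : P → Submodule ℝ E) (ψ : P → CP 1) (p₀ : P)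
    (A : Submodule ℝ E) : Prop :=
  (∀ v ∈ Q p₀, dmap E ψ p₀ v = 0) → ∃ (k : ℕ) (e : Fin k → P → E), IsComplexFrameAt f Q p₀ e ∧
    (tangentSigma E k ⊓ liftDistribution k A) ⊔ (tangentGraph ψ p₀ e ⊓ liftDistribution k A) =
      liftDistribution k A

end Jets

/-- The pencil of hyperplanes `L`, with `Φ = [H₀ : H₁]` and `φ = Φ|M`, defines a (degree one)
Lefschetz pencil structure for the CR manifold `M`. -/
structure DefinesLefschetzPencilStructure [IsManifold (𝓡 (2 * n + 1)) 1 M]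
    (L : HyperplanePencil (n + 1)) : Prop where
  /-- Any two hyperplanes of the pencil intersect transversally, in the base locus. -/
  hyperplanes_transverse : ∀ H ∈ L.line, ∀ H' ∈ L.line, H ≠ H' →
    linearSubspace (hyperplane H) ∩ linearSubspace (hyperplane H') = L.baseLocus ∧
    ∀ p ∈ L.baseLocus, tangentLinear (hyperplane H) p ⊔ tangentLinear (hyperplane H') p = ⊤
  /-- The base locus is transversal to `M`. -/
  base_transverse : BaseLocusTransverse j L
  /-- On the complement of the base locus, the CR one-jet of `φ`, that is its one-jet along `D`, is
  transversal along `D` to `Σ`. -/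
  jet_transverse : ∀ x, j x ∉ L.baseLocus →
    JetTransverseAt j (crDistribution j) (L.map ∘ j) x (crDistribution j x)
  /-- On the complement of the base locus, the one-jet of `Φ` along the complex envelope of `TM` is
  transversal along `M` to `Σ`. By `complexEnvelope_eq_top`, the complex envelope of the tangent
  bundle of a hypersurface is all of `Tℂℙⁿ⁺¹`, and so is its extension to a neighbourhood of `M`. -/
  envelope_jet_transverse : ∀ x, j x ∉ L.baseLocus →
    JetTransverseAt (id : CP (n + 1) → CP (n + 1)) (fun _ => ⊤) L.map (j x) (tangentM j x)

end Hypersurface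
end

noncomputable section

/-! ### Linear algebra of projective subspaces -/

section LinearAlgebra

variable {N : ℕ}

/-! Lift `M` locally to vectors `z` and its dual map to linear forms `a` (`exists_isLocalLift`).
Modulo `z`, the space `T_xM` is `{Re (a·w) = 0}` and `D_x` is `{a·w = 0}`.

The first equivalence is projective duality, point by point. A complex linear subspace is transverse
to a proper real subspace `T` containing a complex hyperplane exactly when it is not inside that
hyperplane (`sup_eq_top_iff_not_tangentLinear_le`). For the base locus and `T_xM ⊇ D_x`, failure
means that the form `ν(x)` vanishes on `B`, that is, `ν(x) ∈ L`. Dually, differentiating `a·z = 0`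
along `D_x`, where `a·dz = 0`, gives `da·z = 0`. So `dν` maps `D_x` into the tangent space of the
dual hyperplane of `x`, and onto it because `ν` is an immersion and the dimensions agree
(`map_dualMap_crDistribution`). Hence `L` fails to be transverse to the branch at `x` exactly when
it lies in that dual hyperplane, that is, when `x ∈ B`. Both global conditions therefore say that no
`x` satisfies `x ∈ B` and `ν(x) ∈ L` together.

For the second equivalence, transversality of `B` is one of the clauses and the others are
automatic. Distinct hyperplanes of a pencil meet transversally, and `Φ` is a submersion off `B`, so
its full jet never meets `Σ`. For the CR jet, let `f` be the form of the pencil that vanishes at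
`z`, and `W_l` a frame of `D`. The components of the jet are `f·W_l` up to a nonzero factor. At a
singular point `f` vanishes on `D_x`, so `f = r a` with `r ≠ 0`. For `v ∈ D_x` the derivative of `f`
along `v` is a multiple of `f`, and differentiating `a·W_l = 0` turns the derivative of `f·W_l` into
`-r (da(v)·W_l)`. If all of these vanish, `da(v)` is a multiple of `a`
(`exists_fderiv_conormal_eq_smul`), so `dν(v) = 0` and `v = 0`. The derivative of the jet is thus
injective on `D_x`, and both sides have real dimension `2n`, so it is onto the fibre and the jet is
transversal. -/

theorem mem_linearSubspace_iff {W : Submodule ℂ (Fin (N + 1) → ℂ)} {p : CP N} :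
    p ∈ linearSubspace W ↔ p.rep ∈ W := by
  change p.submodule ≤ W ↔ _
  rw [Projectivization.submodule_eq, Submodule.span_singleton_le_iff_mem]

theorem CP.exists_rep_eq_smul {p : CP N} {z : Fin (N + 1) → ℂ} (hz : z ≠ 0) (h : CP.proj z = p) :
    ∃ c : ℂ, c ≠ 0 ∧ p.rep = c • z := by
  rw [CP.proj_of_ne hz] at h
  rw [← h]
  exact CP.rep_mk z hz

theorem mem_linearSubspace_iff_of_proj {W : Submodule ℂ (Fin (N + 1) → ℂ)} {p : CP N}
    {z : Fin (N + 1) → ℂ} (hz : z ≠ 0) (h : CP.proj z = p) : p ∈ linearSubspace W ↔ z ∈ W := by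
  obtain ⟨c, hc, hr⟩ := CP.exists_rep_eq_smul hz h
  rw [mem_linearSubspace_iff, hr, Submodule.smul_mem_iff _ hc]

theorem mem_hyperplane_iff {H : DualCP N} {z : Fin (N + 1) → ℂ} :
    z ∈ hyperplane H ↔ H.rep ⬝ᵥ z = 0 := by
  conv_lhs => rw [← H.mk_rep]
  exact mem_hyperplane_mk H.rep_nonzero z

theorem mem_hyperplane_iff_of_proj {H : DualCP N} {a z : Fin (N + 1) → ℂ} (ha : a ≠ 0)
    (h : CP.proj a = H) : z ∈ hyperplane H ↔ a ⬝ᵥ z = 0 := by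
  rw [← h, CP.proj_of_ne ha]
  exact mem_hyperplane_mk ha z

theorem hyperplane_eq_ker (H : DualCP N) :
    hyperplane H = LinearMap.ker (dotProductBilin ℂ ℂ H.rep) := by
  ext z
  rw [mem_hyperplane_iff, LinearMap.mem_ker, dotProductBilin_apply_apply]

theorem dotProductBilin_ne_zero {a : Fin (N + 1) → ℂ} (ha : a ≠ 0) :
    dotProductBilin ℂ ℂ a ≠ 0 := fun h => ha <| funext fun k => by
  simpa using LinearMap.congr_fun h (Pi.single k 1)

theorem finrank_hyperplane (H : DualCP N) : Module.finrank ℂ (hyperplane H) = N := by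
  have := Module.Dual.finrank_ker_add_one_of_ne_zero (dotProductBilin_ne_zero H.rep_nonzero)
  rw [Module.finrank_fin_fun, ← hyperplane_eq_ker] at this
  omega

theorem isCoatom_hyperplane (H : DualCP N) : IsCoatom (hyperplane H) := by
  rw [hyperplane_eq_ker]
  exact LinearMap.isCoatom_ker_of_surjective
    (LinearMap.surjective (dotProductBilin_ne_zero H.rep_nonzero))

theorem annihilator_sup (V W : Submodule ℂ (Fin (N + 1) → ℂ)) :
    annihilator (V ⊔ W) = annihilator V ⊓ annihilator W := by
  ext z
  constructor
  · exact fun h => ⟨fun a ha => h a (Submodule.mem_sup_left ha),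
      fun a ha => h a (Submodule.mem_sup_right ha)⟩
  · rintro ⟨h, h'⟩ a ha
    obtain ⟨b, hb, c, hc, rfl⟩ := Submodule.mem_sup.1 ha
    rw [add_dotProduct, h b hb, h' c hc, add_zero]

/-- The double annihilator of a linear subspace is the subspace. -/
theorem mem_of_annihilator_le {W : Submodule ℂ (Fin (N + 1) → ℂ)} {a : Fin (N + 1) → ℂ}
    (h : ∀ z ∈ annihilator W, a ⬝ᵥ z = 0) : a ∈ W := by
  by_contra ha
  -- A functional that separates `a` from `W` is the dot product with a vector of `annihilator W`,
  -- and this vector contradicts `h`.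
  obtain ⟨f, hfa, hf⟩ := Submodule.exists_le_ker_of_notMem ha
  have hfz : ∀ z, z ⬝ᵥ (fun i => f (Pi.single i 1)) = f z := fun z => by
    rw [LinearMap.pi_apply_eq_sum_univ f z]
    refine Finset.sum_congr rfl fun i _ => ?_
    rw [smul_eq_mul]
    refine congrArg (z i * ·) (congrArg f (funext fun k => ?_))
    simp [Pi.single_apply, eq_comm]
  refine hfa ?_
  rw [← hfz]
  exact h _ fun b hb => by rw [hfz]; exact hf hb

theorem CP.dproj_eq_zero_iff {z v : Fin (N + 1) → ℂ} (hz : z ≠ 0) :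
    CP.dproj z v = 0 ↔ ∃ c : ℂ, c • z = v := by
  rw [← Submodule.mem_span_singleton, ← CP.ker_dproj hz]
  rfl

theorem ker_dproj_rep (p : CP N) :
    LinearMap.ker (CP.dproj p.rep : (Fin (N + 1) → ℂ) →ₗ[ℂ] (Fin N → ℂ)) = p.submodule := by
  rw [Projectivization.submodule_eq]
  exact CP.ker_dproj p.rep_nonzero

/-- The kernel of `CP.dproj p.rep` is the line `p`, which lies in `W`; so tangency to `ℙ(W)` can be
tested on any lift to `ℂᴺ⁺¹`. -/
theorem dproj_mem_tangentLinear_iff {W : Submodule ℂ (Fin (N + 1) → ℂ)} {p : CP N}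
    (hp : p ∈ linearSubspace W) {w : Fin (N + 1) → ℂ} :
    CP.dproj p.rep w ∈ tangentLinear W p ↔ w ∈ W := by
  refine ⟨?_, fun h => ⟨w, h, rfl⟩⟩
  rintro ⟨w', hw', h⟩
  have h1 : w - w' ∈ p.submodule := by
    rw [← ker_dproj_rep, LinearMap.mem_ker, map_sub, h]
    exact sub_self _
  simpa using W.add_mem (hp h1) hw'

theorem tangentLinear_le_iff {W W' : Submodule ℂ (Fin (N + 1) → ℂ)} {p : CP N}
    (hp : p ∈ linearSubspace W') : tangentLinear W p ≤ tangentLinear W' p ↔ W ≤ W' := by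
  refine ⟨fun h w hw => ?_, fun h => Submodule.map_mono h⟩
  exact (dproj_mem_tangentLinear_iff hp).1 (h ⟨w, hw, rfl⟩)

theorem tangentLinear_top (p : CP N) : tangentLinear ⊤ p = ⊤ := by
  rw [tangentLinear, Submodule.map_top, LinearMap.range_eq_top]
  exact CP.surjective_dproj p.rep_nonzero

theorem tangentLinear_sup (W W' : Submodule ℂ (Fin (N + 1) → ℂ)) (p : CP N) :
    tangentLinear (W ⊔ W') p = tangentLinear W p ⊔ tangentLinear W' p :=
  Submodule.map_sup _ _ _

theorem finrank_tangentLinear_hyperplane {H : DualCP N} {p : CP N}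
    (hp : p ∈ linearSubspace (hyperplane H)) :
    Module.finrank ℂ (tangentLinear (hyperplane H) p) + 1 = N := by
  set d := (CP.dproj p.rep : (Fin (N + 1) → ℂ) →ₗ[ℂ] (Fin N → ℂ)) with hd
  have h1 := LinearMap.finrank_range_add_finrank_ker (d.domRestrict (hyperplane H))
  have h2 : Module.finrank ℂ (LinearMap.ker (d.domRestrict (hyperplane H))) = 1 := by
    have hle : LinearMap.ker d ≤ hyperplane H := by rw [ker_dproj_rep]; exact hp
    rw [LinearMap.ker_domRestrict, LinearEquiv.finrank_eq (Submodule.comapSubtypeEquivOfLe hle),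
      ker_dproj_rep]
    exact p.finrank_submodule
  rw [LinearMap.range_domRestrict, h2, finrank_hyperplane] at h1
  exact h1

/-- A complex subspace is transverse to a real hyperplane if and only if it is not contained in a
given complex hyperplane inside the real one. -/
theorem sup_eq_top_iff_not_tangentLinear_le {W : Submodule ℂ (Fin (N + 1) → ℂ)} {H : DualCP N}
    {p : CP N} (hp : p ∈ linearSubspace (hyperplane H)) {T : Submodule ℝ (Fin N → ℂ)}
    (hT : T ≠ ⊤) (hHT : (tangentLinear (hyperplane H) p).restrictScalars ℝ ≤ T) :
    (tangentLinear W p).restrictScalars ℝ ⊔ T = ⊤ ↔ ¬ W ≤ hyperplane H := by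
  rw [← tangentLinear_le_iff hp]
  constructor
  · intro h hle
    refine hT ?_
    rwa [sup_eq_right.2] at h
    exact le_trans (fun v hv => hle hv) hHT
  · intro h
    have hWH : ¬ W ≤ hyperplane H := fun hle => h ((tangentLinear_le_iff hp).2 hle)
    -- Hyperplanes are maximal, so `W` and `hyperplane H` span; after projection, the second summand
    -- is absorbed by `T`.
    have h1 : W ⊔ hyperplane H = ⊤ :=
      (isCoatom_hyperplane H).2 _ (right_lt_sup.2 hWH)
    have h2 : tangentLinear W p ⊔ tangentLinear (hyperplane H) p = ⊤ := by
      rw [← tangentLinear_sup, h1, tangentLinear_top]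
    rw [eq_top_iff]
    intro v _
    obtain ⟨v₁, hv₁, v₂, hv₂, rfl⟩ := Submodule.mem_sup.1 (h2 ▸ Submodule.mem_top (x := v))
    exact Submodule.add_mem_sup hv₁ (hHT hv₂)

namespace HyperplanePencil

variable (L : HyperplanePencil N)

theorem finrank_span : Module.finrank ℂ L.span = 2 := by
  rw [span, finrank_span_eq_card L.linearIndependent, Fintype.card_fin]

theorem mem_baseLocus_iff_of_proj {p : CP N} {z : Fin (N + 1) → ℂ} (hz : z ≠ 0)
    (h : CP.proj z = p) : p ∈ L.baseLocus ↔ ∀ i, L.form i ⬝ᵥ z = 0 := by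
  rw [baseLocus, mem_linearSubspace_iff_of_proj hz h]
  refine ⟨fun hz i => hz _ (Submodule.subset_span ⟨i, rfl⟩), fun hz a ha => ?_⟩
  induction ha using Submodule.span_induction with
  | mem a ha => obtain ⟨i, rfl⟩ := ha; exact hz i
  | zero => exact zero_dotProduct z
  | add a b _ _ ha hb => rw [add_dotProduct, ha, hb, add_zero]
  | smul c a _ ha => rw [smul_dotProduct, ha, smul_zero]

theorem sup_submodule_eq_span {H H' : DualCP N} (hH : H ∈ L.line) (hH' : H' ∈ L.line)
    (hne : H ≠ H') : H.submodule ⊔ H'.submodule = L.span := by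
  refine Submodule.eq_of_le_of_finrank_le (sup_le hH hH') ?_
  rw [L.finrank_span]
  have h1 := H.finrank_submodule
  have h2 : H.submodule < H.submodule ⊔ H'.submodule := by
    refine left_lt_sup.2 fun h => hne ?_
    refine Projectivization.submodule_injective (Submodule.eq_of_le_of_finrank_le h ?_).symm
    rw [h1, H'.finrank_submodule]
  have := Submodule.finrank_lt_finrank_of_lt h2
  omega

theorem hyperplanes_transverse {H H' : DualCP N} (hH : H ∈ L.line) (hH' : H' ∈ L.line)
    (hne : H ≠ H') :
    linearSubspace (hyperplane H) ∩ linearSubspace (hyperplane H') = L.baseLocus ∧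
    ∀ p ∈ L.baseLocus, tangentLinear (hyperplane H) p ⊔ tangentLinear (hyperplane H') p = ⊤ := by
  constructor
  · rw [baseLocus, ← L.sup_submodule_eq_span hH hH' hne, annihilator_sup]
    ext p
    exact (le_inf_iff : p.submodule ≤ _ ⊓ _ ↔ _).symm
  · intro p _
    rw [← tangentLinear_sup, (isCoatom_hyperplane H).sup_eq_top_of_ne (isCoatom_hyperplane H')
      (fun h => hne (hyperplane_injective h)), tangentLinear_top]

end HyperplanePencil

/-- The graph of a one-jet whose last component has a derivative that maps `A` onto the fibre is
transversal to `Σ` along `A`. -/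
theorem sup_tangentSigma_eq_of_surjOn {E : Type*} [NormedAddCommGroup E] [NormedSpace ℝ E] {k : ℕ}
    (A : Submodule ℝ E) (d : E →ₗ[ℝ] (Fin 1 → ℂ)) (D : E →ₗ[ℝ] (Fin k → Fin 1 → ℂ))
    (h : ∀ η, ∃ v ∈ A, D v = η) :
    (tangentSigma E k ⊓ liftDistribution k A) ⊔
      (LinearMap.range ((LinearMap.id : E →ₗ[ℝ] E).prod (d.prod D)) ⊓ liftDistribution k A) =
      liftDistribution k A := by
  refine le_antisymm (sup_le inf_le_right inf_le_right) ?_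
  rintro ⟨u, y, η⟩ ⟨hu, -⟩
  obtain ⟨v, hv, rfl⟩ := h η
  -- The graph vector over `v` supplies the whole fibre component; what is left is tangent to `Σ`.
  refine Submodule.mem_sup.2 ⟨(u - v, y - d v, 0), ⟨?_, A.sub_mem hu hv, trivial⟩, (v, d v, D v),
    ⟨⟨v, rfl⟩, hv, trivial⟩, by simp⟩
  exact ⟨trivial, trivial, rfl⟩

end LinearAlgebra

/-! ### Smoothness of the projection to projective space -/

section Smoothness

variable {N : ℕ}

/-- The section of `v ↦ [v]` over `{z_i ≠ 0}` with values in `{z_i = 1}`. -/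
def affSection (i : Fin (N + 1)) (p : CP N) : Fin (N + 1) → ℂ :=
  i.insertNth (1 : ℂ) (CP.affCoord i p)

theorem affSection_ne_zero (i : Fin (N + 1)) (p : CP N) : affSection i p ≠ 0 :=
  CP.insertNth_ne_zero i _

theorem proj_affSection {i : Fin (N + 1)} {p : CP N} (hp : p.rep i ≠ 0) :
    CP.proj (affSection i p) = p := by
  rw [CP.proj_of_ne (affSection_ne_zero i p)]
  exact (CP.affChart i).left_inv hp

theorem CP.affChart_mem_atlas (i : Fin (N + 1)) :
    CP.affChart i ∈ atlas (Fin N → ℂ) (CP N) := Set.mem_range_self i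

theorem contMDiffAt_affCoord {i : Fin (N + 1)} {p : CP N} (hp : p.rep i ≠ 0) :
    ContMDiffAt 𝓘(ℝ, Fin N → ℂ) 𝓘(ℝ, Fin N → ℂ) ω (CP.affCoord i) p :=
  contMDiffAt_of_mem_maximalAtlas
    (IsManifold.subset_maximalAtlas (CP.affChart_mem_atlas i)) hp

theorem contMDiffAt_affSection {i : Fin (N + 1)} {p : CP N} (hp : p.rep i ≠ 0) :
    ContMDiffAt 𝓘(ℝ, Fin N → ℂ) 𝓘(ℝ, Fin (N + 1) → ℂ) ω (affSection i) p := by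
  have h : ContDiff ℝ ω fun w : Fin N → ℂ => (i.insertNth (1 : ℂ) w : Fin (N + 1) → ℂ) := by
    refine contDiff_pi.2 fun k => Fin.succAboveCases i ?_ (fun k => ?_) k
    · simpa using contDiff_const
    · simpa using contDiff_apply ℝ ℂ k
  exact h.contMDiff.contMDiffAt.comp p (contMDiffAt_affCoord hp)

theorem proj_eventuallyEq {z : Fin (N + 1) → ℂ} {i : Fin (N + 1)} (hi : z i ≠ 0) :
    (CP.proj : (Fin (N + 1) → ℂ) → CP N) =ᶠ[𝓝 z]
      fun v => (CP.affChart i).symm fun k => v (i.succAbove k) / v i := by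
  have ho : IsOpen {v : Fin (N + 1) → ℂ | v i ≠ 0} :=
    isOpen_ne_fun (continuous_apply i) continuous_const
  filter_upwards [ho.mem_nhds hi] with v hv
  have hv0 : v ≠ 0 := fun h => hv (congrFun h i)
  rw [CP.proj_of_ne hv0, ← CP.affCoord_mk i v hv0]
  exact ((CP.affChart i).left_inv ((CP.rep_mk_ne_zero_iff v hv0 i).2 hv)).symm

theorem contMDiffAt_proj {z : Fin (N + 1) → ℂ} (hz : z ≠ 0) :
    ContMDiffAt 𝓘(ℂ, Fin (N + 1) → ℂ) 𝓘(ℂ, Fin N → ℂ) ω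
      (CP.proj : (Fin (N + 1) → ℂ) → CP N) z := by
  obtain ⟨i, hi⟩ := Function.ne_iff.1 hz
  have h1 : ContDiffAt ℂ ω
      (fun v : Fin (N + 1) → ℂ => (fun k => v (i.succAbove k) / v i : Fin N → ℂ)) z :=
    contDiffAt_pi.2 fun k => ContDiffAt.div (contDiff_apply ℂ ℂ _).contDiffAt
      (contDiff_apply ℂ ℂ i).contDiffAt hi
  have h2 : ContMDiff 𝓘(ℂ, Fin N → ℂ) 𝓘(ℂ, Fin N → ℂ) ω (CP.affChart i).symm := by
    rw [← contMDiffOn_univ]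
    exact contMDiffOn_symm_of_mem_maximalAtlas
      (IsManifold.subset_maximalAtlas (CP.affChart_mem_atlas i))
  exact (h2.contMDiffAt.comp z h1.contMDiffAt).congr_of_eventuallyEq (proj_eventuallyEq hi)

/-- Links `CP.dproj`, a derivative over `ℂ`, with `dmap`, a derivative over `ℝ`: in the charts a
complex derivative restricts to the real one. -/
theorem hasMFDerivAt_proj {z : Fin (N + 1) → ℂ} (hz : z ≠ 0) :
    HasMFDerivAt 𝓘(ℝ, Fin (N + 1) → ℂ) 𝓘(ℝ, Fin N → ℂ)
      (CP.proj : (Fin (N + 1) → ℂ) → CP N) z ((CP.dproj z).restrictScalars ℝ) := by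
  have h := ((contMDiffAt_proj hz).mdifferentiableAt (by simp)).hasMFDerivAt
  refine ⟨h.1, ?_⟩
  have h2 := h.2
  simp only [mfld_simps] at h2 ⊢
  exact h2.restrictScalars ℝ

namespace HyperplanePencil

variable (L : HyperplanePencil N)

/-- The two linear forms of the pencil, as a linear map to `ℂ²`. -/
def evalForms : (Fin (N + 1) → ℂ) →L[ℂ] (Fin 2 → ℂ) :=
  LinearMap.toContinuousLinearMap (Matrix.mulVecLin (Matrix.of L.form))

theorem evalForms_apply (z : Fin (N + 1) → ℂ) (i : Fin 2) : L.evalForms z i = L.form i ⬝ᵥ z := rfl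

theorem surjective_evalForms : Function.Surjective L.evalForms := by
  have h : LinearMap.range (L.evalForms : (Fin (N + 1) → ℂ) →ₗ[ℂ] (Fin 2 → ℂ)) = ⊤ := by
    refine Submodule.eq_top_of_finrank_eq ?_
    rw [Module.finrank_fin_fun]
    have : (Matrix.of L.form).rank = Fintype.card (Fin 2) :=
      LinearIndependent.rank_matrix L.linearIndependent
    exact this.trans (Fintype.card_fin 2)
  exact LinearMap.range_eq_top.1 h

theorem evalForms_eq_zero_iff_of_proj {p : CP N} {z : Fin (N + 1) → ℂ} (hz : z ≠ 0)
    (h : CP.proj z = p) : L.evalForms z = 0 ↔ p ∈ L.baseLocus := by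
  rw [L.mem_baseLocus_iff_of_proj hz h]
  exact funext_iff

theorem map_proj {z : Fin (N + 1) → ℂ} (hz : z ≠ 0) :
    L.map (CP.proj z) = CP.proj (L.evalForms z) := by
  obtain ⟨c, hc, hr⟩ := CP.exists_rep_eq_smul hz rfl
  have h : (fun i => L.form i ⬝ᵥ (CP.proj z : CP N).rep) = c • L.evalForms z := by
    funext i
    rw [hr, dotProduct_smul]
    rfl
  rw [map, h]
  -- Over the base locus both sides are the default value of `CP.proj` at `0`.
  by_cases h0 : L.evalForms z = 0
  · rw [h0, smul_zero]
  · rw [CP.proj_of_ne h0, CP.proj_of_ne (smul_ne_zero hc h0), Projectivization.mk_eq_mk_iff']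
    exact ⟨c, rfl⟩

theorem mdifferentiableAt_map {p : CP N} (hp : p ∉ L.baseLocus) :
    MDifferentiableAt 𝓘(ℝ, Fin N → ℂ) 𝓘(ℝ, Fin 1 → ℂ) L.map p := by
  obtain ⟨i, hi⟩ := CP.exists_rep_ne_zero p
  have h0 : L.evalForms (affSection i p) ≠ 0 := fun h =>
    hp ((L.evalForms_eq_zero_iff_of_proj (affSection_ne_zero i p) (proj_affSection hi)).1 h)
  have h1 : MDifferentiableAt 𝓘(ℝ, Fin N → ℂ) 𝓘(ℝ, Fin 1 → ℂ)
      (fun q => CP.proj (L.evalForms (affSection i q))) p := by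
    have h2 := (contMDiffAt_affSection hi).mdifferentiableAt (by simp)
    have h3 : MDifferentiableAt 𝓘(ℝ, Fin N → ℂ) 𝓘(ℝ, Fin 2 → ℂ)
        (fun q => L.evalForms (affSection i q)) p :=
      ((L.evalForms.restrictScalars ℝ).contMDiff (n := 1)).contMDiffAt.mdifferentiableAt
        (by simp) |>.comp p h2
    exact (hasMFDerivAt_proj h0).mdifferentiableAt.comp p h3
  refine h1.congr_of_eventuallyEq ?_
  filter_upwards [(CP.isOpen_source i).mem_nhds hi] with q hq
  rw [← L.map_proj (affSection_ne_zero i q), proj_affSection hq]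

/-- Differentiate `L.map ∘ CP.proj = CP.proj ∘ L.evalForms`: the right side is a composition of
submersions where `L.evalForms` is nonzero. -/
theorem surjective_dmap_map {p : CP N} (hp : p ∉ L.baseLocus) :
    Function.Surjective (dmap (Fin N → ℂ) L.map p) := by
  have hr : CP.proj p.rep = p := CP.proj_rep p
  have h0 : L.evalForms p.rep ≠ 0 := fun h =>
    hp ((L.evalForms_eq_zero_iff_of_proj p.rep_nonzero hr).1 h)
  have h1 : HasMFDerivAt 𝓘(ℝ, Fin (N + 1) → ℂ) 𝓘(ℝ, Fin 1 → ℂ)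
      (fun z => CP.proj (L.evalForms z)) p.rep
      (((CP.dproj (L.evalForms p.rep)).restrictScalars ℝ).comp (L.evalForms.restrictScalars ℝ)) :=
    (hasMFDerivAt_proj h0).comp p.rep (L.evalForms.restrictScalars ℝ).hasMFDerivAt
  have hd : HasMFDerivAt 𝓘(ℝ, Fin N → ℂ) 𝓘(ℝ, Fin 1 → ℂ) L.map (CP.proj p.rep)
      (dmap (Fin N → ℂ) L.map p) := by
    rw [hr]
    exact (L.mdifferentiableAt_map hp).hasMFDerivAt
  have h2 := hd.comp p.rep (hasMFDerivAt_proj p.rep_nonzero)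
  have h3 := h1.congr_of_eventuallyEq (f₁ := L.map ∘ CP.proj) (by
    filter_upwards [isOpen_ne.mem_nhds p.rep_nonzero] with z hz
    exact L.map_proj hz)
  have h4 := hasMFDerivAt_unique h2 h3
  intro y
  obtain ⟨z, rfl⟩ := CP.surjective_dproj h0 y
  obtain ⟨v, rfl⟩ := L.surjective_evalForms z
  exact ⟨CP.dproj p.rep v, DFunLike.congr_fun h4 v⟩

end HyperplanePencil

end Smoothness

/-! ### Dot products of differentiable maps -/

section DotProduct

variable {E : Type*} [NormedAddCommGroup E] [NormedSpace ℝ E] {ι : Type*} [Fintype ι]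
  {a z : E → ι → ℂ} {u : E}

theorem HasFDerivAt.dotProduct_apply {a' z' : E →L[ℝ] (ι → ℂ)} (ha : HasFDerivAt a a' u)
    (hz : HasFDerivAt z z' u) :
    ∃ D : E →L[ℝ] ℂ, HasFDerivAt (fun u => a u ⬝ᵥ z u) D u ∧
      ∀ v, D v = a u ⬝ᵥ z' v + a' v ⬝ᵥ z u := by
  refine ⟨_, HasFDerivAt.fun_sum (u := Finset.univ) fun i _ =>
    ((hasFDerivAt_pi'.1 ha) i).mul ((hasFDerivAt_pi'.1 hz) i), fun v => ?_⟩
  simp [dotProduct, Finset.sum_add_distrib, mul_comm]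

theorem ContDiffAt.dotProduct {m : WithTop ℕ∞} (ha : ContDiffAt ℝ m a u)
    (hz : ContDiffAt ℝ m z u) : ContDiffAt ℝ m (fun u => a u ⬝ᵥ z u) u :=
  ContDiffAt.sum fun i _ => (contDiffAt_pi.1 ha i).mul (contDiffAt_pi.1 hz i)

/-- Differentiation of the identity `a ⬝ᵥ z = 0`. -/
theorem dotProduct_fderiv_add_eq_zero (ha : DifferentiableAt ℝ a u) (hz : DifferentiableAt ℝ z u)
    (h : ∀ᶠ u in 𝓝 u, a u ⬝ᵥ z u = 0) (v : E) :
    a u ⬝ᵥ fderiv ℝ z u v + fderiv ℝ a u v ⬝ᵥ z u = 0 := by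
  obtain ⟨D, hD, hDv⟩ := ha.hasFDerivAt.dotProduct_apply hz.hasFDerivAt
  have h0 : HasFDerivAt (fun u => a u ⬝ᵥ z u) (0 : E →L[ℝ] ℂ) u :=
    (hasFDerivAt_const (0 : ℂ) u).congr_of_eventuallyEq h
  rw [← hDv, hD.unique h0, zero_apply]

end DotProduct

/-! ### Conormals of a family of real hyperplanes -/

section Conormal

variable {E : Type*} [NormedAddCommGroup E] [NormedSpace ℝ E] [FiniteDimensional ℝ E] {N : ℕ}

/-- A real linear form on `ℂᴺ⁺¹` is the real part of a complex one. -/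
def complexGradient (f : (Fin (N + 1) → ℂ) →L[ℝ] ℝ) : Fin (N + 1) → ℂ :=
  fun i => f (Pi.single i 1) - Complex.I * f (Pi.single i Complex.I)

theorem re_complexGradient_dotProduct (f : (Fin (N + 1) → ℂ) →L[ℝ] ℝ) (w : Fin (N + 1) → ℂ) :
    (complexGradient f ⬝ᵥ w).re = f w := by
  have h : w = ∑ i, ((w i).re • (Pi.single i 1 : Fin (N + 1) → ℂ) +
      (w i).im • (Pi.single i Complex.I : Fin (N + 1) → ℂ)) := by
    funext k
    rw [Finset.sum_apply, Finset.sum_eq_single k]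
    · simp
    · intro i _ hi
      simp [hi.symm]
    · simp
  conv_rhs => rw [h]
  rw [map_sum, dotProduct, Complex.re_sum]
  refine Finset.sum_congr rfl fun i _ => ?_
  simp [complexGradient]
  ring

theorem dotProduct_eq_zero_iff_re {a w : Fin (N + 1) → ℂ} :
    a ⬝ᵥ w = 0 ↔ (a ⬝ᵥ w).re = 0 ∧ (a ⬝ᵥ (Complex.I • w)).re = 0 := by
  rw [dotProduct_smul, smul_eq_mul]
  constructor
  · intro h
    simp [h]
  · rintro ⟨h1, h2⟩
    apply Complex.ext
    · exact h1
    · simpa using h2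

/-- The cone over a `C²` real hypersurface `u ↦ [z(u)]` of `ℂℙᴺ` has a `C¹` field of complex
conormals `a`, and its tangent vectors can be lifted in a `C¹` way. -/
theorem exists_conormal {z : E → Fin (N + 1) → ℂ} {u₀ : E} (hz : ContDiffAt ℝ 2 z u₀)
    (hdim : Module.finrank ℝ E + 1 = 2 * N)
    (hinj : ∀ e (c : ℂ), fderiv ℝ z u₀ e + c • z u₀ = 0 → e = 0 ∧ c = 0) :
    ∃ (a : E → Fin (N + 1) → ℂ) (b : E → (Fin (N + 1) → ℂ) →L[ℝ] E),
      ContDiffAt ℝ 1 a u₀ ∧ ContDiffAt ℝ 1 b u₀ ∧ ∀ᶠ u in 𝓝 u₀, a u ≠ 0 ∧ a u ⬝ᵥ z u = 0 ∧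
        (∀ e, (a u ⬝ᵥ fderiv ℝ z u e).re = 0) ∧
        ∀ w, (a u ⬝ᵥ w).re = 0 → ∃ c : ℂ, w = fderiv ℝ z u (b u w) + c • z u := by
  have hfin : Module.finrank ℝ (Fin (N + 1) → ℂ) = 2 * (N + 1) := by
    rw [finrank_real_of_complex, Module.finrank_fin_fun]
  let S : (Fin (N + 1) → ℂ) →L[ℝ] ℂ →L[ℝ] (Fin (N + 1) → ℂ) :=
    (ContinuousLinearMap.lsmul ℝ ℂ).flip
  let C : E → E × ℂ →L[ℝ] (Fin (N + 1) → ℂ) := fun u =>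
    (fderiv ℝ z u).coprod (S (z u))
  -- The range of `C u` is the tangent space of the cone. Its source has dimension `2N + 1`, one
  -- less than the ambient space, so one transverse vector `w₀` completes `C u₀` to an isomorphism
  -- `A u₀`.
  obtain ⟨w₀, hw₀⟩ : ∃ w₀, w₀ ∉ LinearMap.range (C u₀).toLinearMap := by
    by_contra! h
    have h1 := LinearMap.finrank_le_finrank_of_surjective (f := (C u₀).toLinearMap) h
    rw [hfin, Module.finrank_prod, Complex.finrank_real_complex] at h1
    omega
  let A : E → (E × ℂ) × ℝ →L[ℝ] (Fin (N + 1) → ℂ) := fun u =>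
    (C u).coprod ((ContinuousLinearMap.id ℝ ℝ).smulRight w₀)
  have hA : ∀ u e (c : ℂ) (t : ℝ), A u ((e, c), t) = fderiv ℝ z u e + c • z u + t • w₀ :=
    fun u e c t => rfl
  have hAinj : Function.Injective (A u₀).toLinearMap := by
    rw [← LinearMap.ker_eq_bot, LinearMap.ker_eq_bot']
    rintro ⟨⟨e, c⟩, t⟩ h
    rw [ContinuousLinearMap.coe_coe, hA] at h
    have ht : t = 0 := by
      by_contra ht
      refine hw₀ ⟨-t⁻¹ • (e, c), ?_⟩
      have h1 : C u₀ (e, c) = -(t • w₀) := eq_neg_of_add_eq_zero_left h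
      rw [ContinuousLinearMap.coe_coe, map_smul, h1, smul_neg, neg_smul, neg_neg,
        inv_smul_smul₀ ht]
    rw [ht, zero_smul, add_zero] at h
    obtain ⟨rfl, rfl⟩ := hinj e c h
    rw [ht]
    rfl
  have hAdim : Module.finrank ℝ ((E × ℂ) × ℝ) = Module.finrank ℝ (Fin (N + 1) → ℂ) := by
    rw [hfin, Module.finrank_prod, Module.finrank_prod, Complex.finrank_real_complex,
      Module.finrank_self]
    omega
  let A₀ : ((E × ℂ) × ℝ) ≃L[ℝ] (Fin (N + 1) → ℂ) :=
    (LinearEquiv.ofInjectiveOfFinrankEq (A u₀).toLinearMap hAinj hAdim).toContinuousLinearEquiv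
  have hA₀ : A u₀ = A₀ := by
    refine ContinuousLinearMap.ext fun v => ?_
    rfl
  have hzd : ContDiffAt ℝ 1 (fderiv ℝ z) u₀ := hz.fderiv_right (by norm_num)
  have hz1 : ContDiffAt ℝ 1 z u₀ := hz.of_le (by norm_num)
  have hAc : ContDiffAt ℝ 1 A u₀ := by
    have h1 : ContDiffAt ℝ 1 C u₀ := by
      have h2 : ContDiffAt ℝ 1 (fun u => S (z u)) u₀ :=
        S.contDiff.contDiffAt.comp u₀ hz1
      have h3 : C = fun u => (fderiv ℝ z u).comp (ContinuousLinearMap.fst ℝ E ℂ) +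
          (S (z u)).comp (ContinuousLinearMap.snd ℝ E ℂ) := by
        funext u
        refine ContinuousLinearMap.ext fun v => ?_
        rfl
      rw [h3]
      exact (hzd.clm_comp contDiffAt_const).add (h2.clm_comp contDiffAt_const)
    have h3 : A = fun u => (C u).comp (ContinuousLinearMap.fst ℝ (E × ℂ) ℝ) +
        ((ContinuousLinearMap.id ℝ ℝ).smulRight w₀).comp (ContinuousLinearMap.snd ℝ (E × ℂ) ℝ) := by
      funext u
      refine ContinuousLinearMap.ext fun v => ?_
      rfl
    rw [h3]
    exact (h1.clm_comp contDiffAt_const).add contDiffAt_const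
  let B : E → (Fin (N + 1) → ℂ) →L[ℝ] (E × ℂ) × ℝ := fun u => (A u).inverse
  have hB : ContDiffAt ℝ 1 B u₀ := by
    have h := contDiffAt_map_inverse (𝕜 := ℝ) (n := 1) A₀
    rw [← hA₀] at h
    exact h.comp u₀ hAc
  have hinv : ∀ᶠ u in 𝓝 u₀, (A u).IsInvertible := by
    refine hAc.continuousAt.eventually (p := fun T => T.IsInvertible) ?_
    rw [hA₀]
    exact ContinuousLinearEquiv.nhds A₀
  -- The `w₀`-coordinate is a real conormal: its kernel is the tangent space of the cone. Inversion
  -- is smooth, so `l` is as regular as `fderiv ℝ z`.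
  let l : E → (Fin (N + 1) → ℂ) →L[ℝ] ℝ := fun u =>
    (ContinuousLinearMap.snd ℝ (E × ℂ) ℝ).comp (B u)
  have hl : ContDiffAt ℝ 1 l u₀ := contDiffAt_const.clm_comp hB
  refine ⟨fun u => complexGradient (l u), fun u => (ContinuousLinearMap.fst ℝ E ℂ).comp
    ((ContinuousLinearMap.fst ℝ (E × ℂ) ℝ).comp (B u)), ?_, ?_, ?_⟩
  · refine contDiffAt_pi.2 fun i => ?_
    have h : ∀ w, ContDiffAt ℝ 1 (fun u => ((l u w : ℝ) : ℂ)) u₀ := fun w =>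
      Complex.ofRealCLM.contDiff.contDiffAt.comp u₀ (hl.clm_apply contDiffAt_const)
    exact (h _).sub (contDiffAt_const.mul (h _))
  · exact contDiffAt_const.clm_comp (contDiffAt_const.clm_comp hB)
  · filter_upwards [hinv] with u hu
    have hlA : ∀ e c t, l u (fderiv ℝ z u e + c • z u + t • w₀) = t := fun e c t => by
      rw [← hA]
      change (B u (A u ((e, c), t))).2 = t
      rw [hu.inverse_apply_self]
    refine ⟨fun h => ?_, ?_, fun e => ?_, fun w hw => ?_⟩
    · have h1 := hlA 0 0 1
      rw [← re_complexGradient_dotProduct, h, zero_dotProduct] at h1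
      simp at h1
    -- The cone is invariant under complex scaling, so both `z` and `i z` are tangent to it.
    · rw [dotProduct_eq_zero_iff_re, re_complexGradient_dotProduct, re_complexGradient_dotProduct]
      have h1 := hlA 0 1 0
      have h2 := hlA 0 Complex.I 0
      simp only [map_zero, zero_add, zero_smul, add_zero, one_smul] at h1 h2
      exact ⟨h1, h2⟩
    · rw [re_complexGradient_dotProduct]
      simpa using hlA e 0 0
    · rw [re_complexGradient_dotProduct] at hw
      have h1 : A u ((((B u w).1.1, (B u w).1.2)), (B u w).2) = w := hu.self_apply_inverse w
      have hw' : (B u w).2 = 0 := hw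
      rw [hA, hw', zero_smul, add_zero] at h1
      exact ⟨_, h1.symm⟩

end Conormal

/-! ### Derivatives in terms of lifts to `ℂᴺ⁺¹` -/

section Lifts

variable {N : ℕ}

/-- `CP.proj` is invariant under scaling. This allows any lift of a point to replace its chosen
representative `rep`. -/
theorem dproj_smul_smul {c : ℂ} (hc : c ≠ 0) {z : Fin (N + 1) → ℂ} (hz : z ≠ 0)
    (v : Fin (N + 1) → ℂ) : CP.dproj (c • z) (c • v) = CP.dproj z v := by
  let m : (Fin (N + 1) → ℂ) →L[ℝ] (Fin (N + 1) → ℂ) :=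
    (c • ContinuousLinearMap.id ℂ (Fin (N + 1) → ℂ)).restrictScalars ℝ
  have h1 : HasMFDerivAt 𝓘(ℝ, Fin (N + 1) → ℂ) 𝓘(ℝ, Fin N → ℂ)
      ((CP.proj : (Fin (N + 1) → ℂ) → CP N) ∘ m) z _ :=
    HasMFDerivAt.comp z (hasMFDerivAt_proj (smul_ne_zero hc hz)) m.hasMFDerivAt
  have h2 := (hasMFDerivAt_proj hz).congr_of_eventuallyEq
      (f₁ := (CP.proj : (Fin (N + 1) → ℂ) → CP N) ∘ m) (by
    filter_upwards [isOpen_ne.mem_nhds hz] with w hw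
    change CP.proj (c • w) = CP.proj w
    rw [CP.proj_of_ne hw, CP.proj_of_ne (smul_ne_zero hc hw), Projectivization.mk_eq_mk_iff']
    exact ⟨c, rfl⟩)
  exact DFunLike.congr_fun (hasMFDerivAt_unique h1 h2) v

theorem dproj_mem_tangentLinear_iff_of_proj {W : Submodule ℂ (Fin (N + 1) → ℂ)} {p : CP N}
    {z : Fin (N + 1) → ℂ} (hz : z ≠ 0) (h : CP.proj z = p) (hzW : z ∈ W)
    {w : Fin (N + 1) → ℂ} : CP.dproj z w ∈ tangentLinear W p ↔ w ∈ W := by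
  obtain ⟨c, hc, hr⟩ := CP.exists_rep_eq_smul hz h
  rw [← dproj_smul_smul hc hz w, ← hr,
    dproj_mem_tangentLinear_iff ((mem_linearSubspace_iff_of_proj hz h).2 hzW),
    Submodule.smul_mem_iff _ hc]

variable {E : Type*} [NormedAddCommGroup E] [NormedSpace ℝ E] {P : Type*} [TopologicalSpace P]
  [ChartedSpace E P] [IsManifold 𝓘(ℝ, E) 1 P]

/-- The chain rule for a map that is given by `g` in the chart of `P` at `x`. -/
theorem hasMFDerivAt_of_chart {E' : Type*} [NormedAddCommGroup E'] [NormedSpace ℝ E'] {f : P → E'}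
    {g : E → E'} {x p : P} (hp : p ∈ (extChartAt 𝓘(ℝ, E) x).source)
    (hg : DifferentiableAt ℝ g (extChartAt 𝓘(ℝ, E) x p))
    (h : ∀ᶠ q in 𝓝 p, f q = g (extChartAt 𝓘(ℝ, E) x q)) :
    HasMFDerivAt 𝓘(ℝ, E) 𝓘(ℝ, E') f p ((fderiv ℝ g (extChartAt 𝓘(ℝ, E) x p)).comp
      (mfderiv 𝓘(ℝ, E) 𝓘(ℝ, E) (extChartAt 𝓘(ℝ, E) x) p : E →L[ℝ] E)) :=
  (HasMFDerivAt.comp p hg.hasFDerivAt.hasMFDerivAt (mdifferentiableAt_extChartAt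
    (by rwa [extChartAt_source] at hp)).hasMFDerivAt).congr_of_eventuallyEq h

/-- The chain rule for a map to `ℂℙᴺ` that is lifted to `z` in the chart of `P` at `x`. -/
theorem hasMFDerivAt_of_lift {f : P → CP N} {z : E → Fin (N + 1) → ℂ} {x p : P}
    (hp : p ∈ (extChartAt 𝓘(ℝ, E) x).source) (hz0 : z (extChartAt 𝓘(ℝ, E) x p) ≠ 0)
    (hz : DifferentiableAt ℝ z (extChartAt 𝓘(ℝ, E) x p))
    (h : ∀ᶠ q in 𝓝 p, f q = CP.proj (z (extChartAt 𝓘(ℝ, E) x q))) :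
    HasMFDerivAt 𝓘(ℝ, E) 𝓘(ℝ, Fin N → ℂ) f p
      (((CP.dproj (z (extChartAt 𝓘(ℝ, E) x p))).restrictScalars ℝ).comp
        ((fderiv ℝ z (extChartAt 𝓘(ℝ, E) x p)).comp
          (mfderiv 𝓘(ℝ, E) 𝓘(ℝ, E) (extChartAt 𝓘(ℝ, E) x) p : E →L[ℝ] E))) :=
  (HasMFDerivAt.comp p (hasMFDerivAt_proj hz0)
    (hasMFDerivAt_of_chart hp hz (Filter.Eventually.of_forall fun _ => rfl))).congr_of_eventuallyEq h

theorem dmap_of_lift {f : P → CP N} {z : E → Fin (N + 1) → ℂ} {x p : P}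
    (hp : p ∈ (extChartAt 𝓘(ℝ, E) x).source) (hz0 : z (extChartAt 𝓘(ℝ, E) x p) ≠ 0)
    (hz : DifferentiableAt ℝ z (extChartAt 𝓘(ℝ, E) x p))
    (h : ∀ᶠ q in 𝓝 p, f q = CP.proj (z (extChartAt 𝓘(ℝ, E) x q))) (v : E) :
    dmap E f p v = CP.dproj (z (extChartAt 𝓘(ℝ, E) x p))
      (fderiv ℝ z (extChartAt 𝓘(ℝ, E) x p)
        ((mfderiv 𝓘(ℝ, E) 𝓘(ℝ, E) (extChartAt 𝓘(ℝ, E) x) p : E →L[ℝ] E) v)) :=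
  DFunLike.congr_fun (hasMFDerivAt_of_lift hp hz0 hz h).mfderiv v

end Lifts

/-! ### Lifts of a hypersurface and of its dual map -/

section LocalLifts

variable {n : ℕ} {M : Type*} [TopologicalSpace M]
  [ChartedSpace (EuclideanSpace ℝ (Fin (2 * n + 1))) M]

/-- The chart of `M` at `x`. -/
abbrev chartM (n : ℕ) {M : Type*} [TopologicalSpace M]
    [ChartedSpace (EuclideanSpace ℝ (Fin (2 * n + 1))) M] (x : M) :
    PartialEquiv M (EuclideanSpace ℝ (Fin (2 * n + 1))) :=
  extChartAt (𝓡 (2 * n + 1)) x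

/-- The differential at `p` of the chart of `M` at `x`. -/
def dchartM (n : ℕ) {M : Type*} [TopologicalSpace M]
    [ChartedSpace (EuclideanSpace ℝ (Fin (2 * n + 1))) M] (x p : M) :
    EuclideanSpace ℝ (Fin (2 * n + 1)) →L[ℝ] EuclideanSpace ℝ (Fin (2 * n + 1)) :=
  mfderiv (𝓡 (2 * n + 1)) 𝓘(ℝ, EuclideanSpace ℝ (Fin (2 * n + 1))) (chartM n x) p

theorem isInvertible_dchartM [IsManifold (𝓡 (2 * n + 1)) 1 M] {x p : M}
    (hp : p ∈ (chartM n x).source) : (dchartM n x p).IsInvertible :=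
  isInvertible_mfderiv_extChartAt hp

/-- `z` and `a` lift `j` and its dual map near `x` to `ℂⁿ⁺²`, in the chart of `M` at `x`, and `b`
lifts tangent vectors of the cone over `M`. -/
structure IsLocalLift (j : M → CP (n + 1)) (x : M)
    (z a : EuclideanSpace ℝ (Fin (2 * n + 1)) → Fin (n + 2) → ℂ)
    (b : EuclideanSpace ℝ (Fin (2 * n + 1)) →
      (Fin (n + 2) → ℂ) →L[ℝ] EuclideanSpace ℝ (Fin (2 * n + 1)))
    (p : M) : Prop where
  mem_source : p ∈ (chartM n x).source
  ne_zero : z (chartM n x p) ≠ 0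
  proj_eq : CP.proj (z (chartM n x p)) = j p
  differentiableAt : DifferentiableAt ℝ z (chartM n x p)
  dmap_eq : ∀ v, dmap (EuclideanSpace ℝ (Fin (2 * n + 1))) j p v =
    CP.dproj (z (chartM n x p)) (fderiv ℝ z (chartM n x p) (dchartM n x p v))
  dual_ne_zero : a (chartM n x p) ≠ 0
  dotProduct_eq_zero : a (chartM n x p) ⬝ᵥ z (chartM n x p) = 0
  dotProduct_fderiv_re : ∀ e, (a (chartM n x p) ⬝ᵥ fderiv ℝ z (chartM n x p) e).re = 0
  exists_eq_of_re : ∀ w, (a (chartM n x p) ⬝ᵥ w).re = 0 →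
    ∃ c : ℂ, w = fderiv ℝ z (chartM n x p) (b (chartM n x p) w) + c • z (chartM n x p)

namespace IsLocalLift

variable {j : M → CP (n + 1)} {x p : M}
  {z a : EuclideanSpace ℝ (Fin (2 * n + 1)) → Fin (n + 2) → ℂ}
  {b : EuclideanSpace ℝ (Fin (2 * n + 1)) →
      (Fin (n + 2) → ℂ) →L[ℝ] EuclideanSpace ℝ (Fin (2 * n + 1))}

theorem dproj_eq_of_re (h : IsLocalLift j x z a b p) {w : Fin (n + 2) → ℂ}
    (hw : (a (chartM n x p) ⬝ᵥ w).re = 0) : CP.dproj (z (chartM n x p)) w =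
      CP.dproj (z (chartM n x p)) (fderiv ℝ z (chartM n x p) (b (chartM n x p) w)) := by
  obtain ⟨c, hc⟩ := h.exists_eq_of_re w hw
  conv_lhs => rw [hc, map_add, (CP.dproj_eq_zero_iff h.ne_zero (v := c • z (chartM n x p))).2 ⟨c, rfl⟩,
    add_zero]

variable [IsManifold (𝓡 (2 * n + 1)) 1 M]

theorem dproj_mem_tangentM_iff (h : IsLocalLift j x z a b p) {w : Fin (n + 2) → ℂ} :
    CP.dproj (z (chartM n x p)) w ∈ tangentM j p ↔ (a (chartM n x p) ⬝ᵥ w).re = 0 := by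
  constructor
  · rintro ⟨v, hv⟩
    have hv' : CP.dproj (z (chartM n x p)) (w - fderiv ℝ z (chartM n x p) (dchartM n x p v)) = 0 := by
      rw [map_sub, ← h.dmap_eq, sub_eq_zero]
      exact hv.symm
    obtain ⟨c, hc⟩ := (CP.dproj_eq_zero_iff h.ne_zero).1 hv'
    rw [← sub_add_cancel w (fderiv ℝ z (chartM n x p) (dchartM n x p v)), ← hc, dotProduct_add,
      dotProduct_smul, h.dotProduct_eq_zero, smul_zero, zero_add]
    exact h.dotProduct_fderiv_re _
  · intro hw
    obtain ⟨v, hv⟩ := (isInvertible_dchartM h.mem_source).surjective (b (chartM n x p) w)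
    refine ⟨v, ?_⟩
    rw [h.dproj_eq_of_re hw, ← hv]
    exact h.dmap_eq v

/-- The largest complex subspace of `{Re (a·w) = 0}` is `{a·w = 0}`. -/
theorem dproj_mem_crTangent_iff (h : IsLocalLift j x z a b p) {w : Fin (n + 2) → ℂ} :
    CP.dproj (z (chartM n x p)) w ∈ crTangent j p ↔ a (chartM n x p) ⬝ᵥ w = 0 := by
  rw [dotProduct_eq_zero_iff_re, ← h.dproj_mem_tangentM_iff, ← h.dproj_mem_tangentM_iff, map_smul]
  rfl

theorem isCRTangentHyperplane (h : IsLocalLift j x z a b p) :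
    IsCRTangentHyperplane j p (CP.proj (a (chartM n x p))) := by
  have hz : z (chartM n x p) ∈ hyperplane (CP.proj (a (chartM n x p)) : DualCP (n + 1)) :=
    (mem_hyperplane_iff_of_proj h.dual_ne_zero rfl).2 h.dotProduct_eq_zero
  refine ⟨(mem_linearSubspace_iff_of_proj h.ne_zero h.proj_eq).2 hz, ?_⟩
  ext v
  obtain ⟨w, rfl⟩ := CP.surjective_dproj h.ne_zero v
  rw [dproj_mem_tangentLinear_iff_of_proj h.ne_zero h.proj_eq hz, h.dproj_mem_crTangent_iff,
    mem_hyperplane_iff_of_proj h.dual_ne_zero rfl]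

/-- Uniqueness of the tangent hyperplane identifies the pointwise choice `dualMap` with the
projection of the `C¹` conormal; the derivative of `dualMap` is computed through this. -/
theorem proj_dual_eq (hj : IsC2Embedding j) (h : IsLocalLift j x z a b p) :
    CP.proj (a (chartM n x p)) = dualMap j p :=
  (existsUnique_crTangentHyperplane hj p).unique h.isCRTangentHyperplane
    (isCRTangentHyperplane_dualMap hj p)

theorem mem_crDistribution_iff (h : IsLocalLift j x z a b p)
    {v : EuclideanSpace ℝ (Fin (2 * n + 1))} : v ∈ crDistribution j p ↔
      a (chartM n x p) ⬝ᵥ fderiv ℝ z (chartM n x p) (dchartM n x p v) = 0 := by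
  rw [← h.dproj_mem_crTangent_iff, ← h.dmap_eq]
  rfl

end IsLocalLift

theorem exists_isLocalLift [IsManifold (𝓡 (2 * n + 1)) 2 M] [IsManifold (𝓡 (2 * n + 1)) 1 M]
    {j : M → CP (n + 1)} (hj : IsC2Embedding j) (x : M) :
    ∃ z a b, ContDiffAt ℝ 2 z (chartM n x x) ∧ ContDiffAt ℝ 1 a (chartM n x x) ∧
      ContDiffAt ℝ 1 b (chartM n x x) ∧ ∀ᶠ p in 𝓝 x, IsLocalLift j x z a b p := by
  obtain ⟨i, hi⟩ := CP.exists_rep_ne_zero (j x)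
  let z : EuclideanSpace ℝ (Fin (2 * n + 1)) → Fin (n + 2) → ℂ :=
    fun u => affSection i (j ((chartM n x).symm u))
  have hxx : (chartM n x).symm (chartM n x x) = x := extChartAt_to_inv x
  have hz : ContDiffAt ℝ 2 z (chartM n x x) := by
    rw [← contMDiffAt_iff_contDiffAt]
    have h1 : ContMDiffAt 𝓘(ℝ, EuclideanSpace ℝ (Fin (2 * n + 1))) (𝓡 (2 * n + 1)) 2
        (chartM n x).symm (chartM n x x) :=
      (contMDiffOn_extChartAt_symm x).contMDiffAt (extChartAt_target_mem_nhds x)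
    have h2 := (contMDiffAt_affSection hi).of_le (n := ω) (m := 2) le_top
    have h3 := h2.comp x hj.contMDiff.contMDiffAt
    rw [← hxx] at h3
    exact h3.comp (chartM n x x) h1
  have hz2 : ∀ᶠ p in 𝓝 x, ContDiffAt ℝ 2 z (chartM n x p) :=
    (continuousAt_extChartAt x).eventually (hz.eventually (by simp))
  have hsource : ∀ᶠ p in 𝓝 x, p ∈ (chartM n x).source := extChartAt_source_mem_nhds x
  have hproj : ∀ᶠ p in 𝓝 x, CP.proj (z (chartM n x p)) = j p := by
    filter_upwards [hsource, hj.contMDiff.continuous.continuousAt.eventually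
      ((CP.isOpen_source i).mem_nhds hi)] with p hp hpi
    have hpp : z (chartM n x p) = affSection i (j p) := by
      simp only [z]
      rw [(chartM n x).left_inv hp]
    rw [hpp]
    exact proj_affSection hpi
  have hdmap : ∀ᶠ p in 𝓝 x, ∀ v, dmap (EuclideanSpace ℝ (Fin (2 * n + 1))) j p v =
      CP.dproj (z (chartM n x p)) (fderiv ℝ z (chartM n x p) (dchartM n x p v)) := by
    filter_upwards [hz2, hsource, hproj.eventually_nhds] with p hp2 hps hpp v
    exact dmap_of_lift hps (affSection_ne_zero _ _) (hp2.differentiableAt (by simp))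
      (hpp.mono fun q hq => hq.symm) v
  -- A relation between `dz(e)` and `z` says that `dj` kills the vector behind `e`, as `CP.dproj z`
  -- kills the radial direction; injectivity of `dj` then gives the nondegeneracy of the cone.
  obtain ⟨a, b, ha, hb, hab⟩ := exists_conormal hz
    (by rw [finrank_euclideanSpace_fin]; ring) (fun e c hec => by
      obtain ⟨v, rfl⟩ := (isInvertible_dchartM
        (mem_extChartAt_source (I := 𝓡 (2 * n + 1)) x)).surjective e
      have h1 : dmap (EuclideanSpace ℝ (Fin (2 * n + 1))) j x v = 0 := by
        rw [hdmap.self_of_nhds v, CP.dproj_eq_zero_iff (affSection_ne_zero _ _)]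
        exact ⟨-c, by rw [neg_smul]; exact (eq_neg_of_add_eq_zero_left hec).symm⟩
      have h2 : v = 0 := hj.injective_dmap x (by rw [h1, map_zero])
      rw [h2] at hec ⊢
      simp only [map_zero, zero_add] at hec
      exact ⟨map_zero _, (smul_eq_zero.1 hec).resolve_right (affSection_ne_zero _ _)⟩)
  refine ⟨z, a, b, hz, ha, hb, ?_⟩
  filter_upwards [hz2, hsource, hproj, hdmap, (continuousAt_extChartAt x).eventually hab]
    with p h1 h2 h3 h4 h5
  exact ⟨h2, affSection_ne_zero _ _, h3, h1.differentiableAt (by simp), h4, h5.1, h5.2.1, h5.2.2.1,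
    h5.2.2.2⟩

end LocalLifts

/-! ### Duality and transversality of the base locus -/

section Duality

variable {n : ℕ} {M : Type*} [TopologicalSpace M]
  [ChartedSpace (EuclideanSpace ℝ (Fin (2 * n + 1))) M] {j : M → CP (n + 1)}

theorem eventually_of_eventually_chartM {x : M} {Q : EuclideanSpace ℝ (Fin (2 * n + 1)) → Prop}
    (h : ∀ᶠ p in 𝓝 x, Q (chartM n x p)) : ∀ᶠ u in 𝓝 (chartM n x x), Q u := by
  rw [← map_extChartAt_nhds_of_boundaryless (I := 𝓡 (2 * n + 1)) x]
  exact h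

theorem crTangent_le_tangentM (x : M) : (crTangent j x).restrictScalars ℝ ≤ tangentM j x :=
  fun _ hv => hv.1

theorem map_crDistribution (x : M) :
    (crDistribution j x).map (dmap (EuclideanSpace ℝ (Fin (2 * n + 1))) j x).toLinearMap =
      (crTangent j x).restrictScalars ℝ := by
  rw [crDistribution, Submodule.map_comap_eq]
  exact inf_eq_right.2 (crTangent_le_tangentM x)

theorem finrank_crTangent (hj : IsC2Embedding j) (x : M) :
    Module.finrank ℂ (crTangent j x) = n :=
  Nat.succ.inj (finrank_maxComplex _ (finrank_tangentM hj x))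

theorem finrank_crDistribution (hj : IsC2Embedding j) (x : M) :
    Module.finrank ℝ (crDistribution j x) = 2 * n := by
  rw [LinearEquiv.finrank_eq (Submodule.equivMapOfInjective _ (hj.injective_dmap x) _),
    map_crDistribution]
  exact (finrank_real_of_complex (crTangent j x)).trans (by rw [finrank_crTangent hj])

theorem tangentM_ne_top (hj : IsC2Embedding j) (x : M) : tangentM j x ≠ ⊤ := by
  intro h
  have h1 := finrank_tangentM hj x
  rw [h, finrank_top, finrank_real_of_complex, Module.finrank_fin_fun] at h1
  omega

theorem tangentBranch_ne_top (x : M) : tangentBranch j x ≠ ⊤ := by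
  intro h
  have h1 := LinearMap.finrank_range_le
    (dmap (EuclideanSpace ℝ (Fin (2 * n + 1))) (dualMap j) x).toLinearMap
  rw [tangentBranch] at h
  rw [h, finrank_euclideanSpace_fin, finrank_top, finrank_real_of_complex,
    Module.finrank_fin_fun] at h1
  omega

/-- Transversality fails when the cone over `B` lies in the hyperplane `ν(x)`, and by double
annihilation the forms vanishing on `B` are those of the pencil. The point `j x` need not lie on `B`
here. -/
theorem baseLocus_transverse_iff (hj : IsC2Embedding j) (L : HyperplanePencil (n + 1)) (x : M) :
    (tangentLinear (annihilator L.span) (j x)).restrictScalars ℝ ⊔ tangentM j x = ⊤ ↔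
      dualMap j x ∉ L.line := by
  obtain ⟨h1, h2⟩ := isCRTangentHyperplane_dualMap hj x
  rw [sup_eq_top_iff_not_tangentLinear_le h1 (tangentM_ne_top hj x)
    (by rw [h2]; exact crTangent_le_tangentM x), not_iff_not, HyperplanePencil.line,
    mem_linearSubspace_iff]
  constructor
  · exact fun h => mem_of_annihilator_le fun z hz => mem_hyperplane_iff.1 (h hz)
  · exact fun h z hz => mem_hyperplane_iff.2 (hz _ h)

theorem mem_linearSubspace_dual (hj : IsC2Embedding j) (x : M) :
    dualMap j x ∈ linearSubspace (hyperplane (j x : DualCP (n + 1))) := by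
  have h := (isCRTangentHyperplane_dualMap hj x).1
  rw [mem_linearSubspace_iff, mem_hyperplane_iff] at h ⊢
  rwa [dotProduct_comm]

variable [IsManifold (𝓡 (2 * n + 1)) 1 M]

/-- The differential of the dual map, in terms of a lift. -/
theorem dmap_dualMap_eq (hj : IsC2Embedding j) {x : M}
    {z a : EuclideanSpace ℝ (Fin (2 * n + 1)) → Fin (n + 2) → ℂ}
    {b : EuclideanSpace ℝ (Fin (2 * n + 1)) →
      (Fin (n + 2) → ℂ) →L[ℝ] EuclideanSpace ℝ (Fin (2 * n + 1))}
    (ha : DifferentiableAt ℝ a (chartM n x x)) (h : ∀ᶠ p in 𝓝 x, IsLocalLift j x z a b p)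
    (v : EuclideanSpace ℝ (Fin (2 * n + 1))) :
    dmap (EuclideanSpace ℝ (Fin (2 * n + 1))) (dualMap j) x v =
      CP.dproj (a (chartM n x x)) (fderiv ℝ a (chartM n x x) (dchartM n x x v)) :=
  dmap_of_lift h.self_of_nhds.mem_source h.self_of_nhds.dual_ne_zero ha
    (h.mono fun _ hp => (hp.proj_dual_eq hj).symm) v

variable [IsManifold (𝓡 (2 * n + 1)) 2 M]

/-- Biduality: the differential of the dual map sends the CR distribution at `x` to the tangent
space of the space of hyperplanes through `x`. -/
theorem map_dualMap_crDistribution (hj : IsC2Embedding j) (hν : HasImmersedDualSet j) (x : M) :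
    (crDistribution j x).map
        (dmap (EuclideanSpace ℝ (Fin (2 * n + 1))) (dualMap j) x).toLinearMap =
      (tangentLinear (hyperplane (j x : DualCP (n + 1))) (dualMap j x)).restrictScalars ℝ := by
  obtain ⟨z, a, b, hz, ha, hb, hev⟩ := exists_isLocalLift hj x
  have h := hev.self_of_nhds
  have ha' : DifferentiableAt ℝ a (chartM n x x) := ha.differentiableAt (by simp)
  refine Submodule.eq_of_le_of_finrank_eq ?_ ?_
  · rintro _ ⟨v, hv, rfl⟩
    change dmap (EuclideanSpace ℝ (Fin (2 * n + 1))) (dualMap j) x v ∈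
      tangentLinear (hyperplane (j x : DualCP (n + 1))) (dualMap j x)
    rw [dmap_dualMap_eq hj ha' hev,
      dproj_mem_tangentLinear_iff_of_proj h.dual_ne_zero (h.proj_dual_eq hj)
        ((mem_hyperplane_iff_of_proj h.ne_zero h.proj_eq).2
          (by rw [dotProduct_comm]; exact h.dotProduct_eq_zero)),
      mem_hyperplane_iff_of_proj h.ne_zero h.proj_eq, dotProduct_comm]
    -- From `a·dz(v) + da(v)·z = 0`; the first term vanishes because `v ∈ D_x`.
    have h1 := dotProduct_fderiv_add_eq_zero ha' h.differentiableAt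
      (eventually_of_eventually_chartM (hev.mono fun _ hp => hp.dotProduct_eq_zero))
      (dchartM n x x v)
    rwa [h.mem_crDistribution_iff.1 hv, zero_add] at h1
  -- Here the immersion hypothesis makes the inclusion an equality: both spaces have real dimension
  -- `2n`.
  · rw [← LinearEquiv.finrank_eq (Submodule.equivMapOfInjective _ (hν x) _),
      finrank_crDistribution hj]
    refine Eq.trans ?_ (finrank_real_of_complex
      (tangentLinear (hyperplane (j x : DualCP (n + 1))) (dualMap j x))).symm
    rw [Nat.succ.inj (finrank_tangentLinear_hyperplane (mem_linearSubspace_dual hj x))]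

/-- The mirror image of `baseLocus_transverse_iff`: by biduality the branch contains the complex
tangent hyperplane dual to `x`, which contains `L` exactly when all forms of `L` vanish at `x`. -/
theorem line_transverse_iff (hj : IsC2Embedding j) (hν : HasImmersedDualSet j)
    (L : HyperplanePencil (n + 1)) (x : M) :
    (tangentLinear L.span (dualMap j x)).restrictScalars ℝ ⊔ tangentBranch j x = ⊤ ↔
      j x ∉ L.baseLocus := by
  rw [sup_eq_top_iff_not_tangentLinear_le (mem_linearSubspace_dual hj x) (tangentBranch_ne_top x)
    (by rw [← map_dualMap_crDistribution hj hν]; exact LinearMap.map_le_range), not_iff_not,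
    HyperplanePencil.baseLocus, mem_linearSubspace_iff]
  refine forall₂_congr fun a _ => ?_
  rw [mem_hyperplane_iff, dotProduct_comm]

theorem isLefschetzPencil_iff (hj : IsC2Embedding j) (hν : HasImmersedDualSet j)
    (L : HyperplanePencil (n + 1)) : IsLefschetzPencil j L ↔ BaseLocusTransverse j L := by
  constructor
  · intro h x hx
    rw [baseLocus_transverse_iff hj L x]
    intro hL
    exact (line_transverse_iff hj hν L x).1 (h _ ⟨hL, x, rfl⟩ x rfl) hx
  · rintro h _ ⟨hL, -⟩ x rfl
    rw [line_transverse_iff hj hν]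
    intro hx
    exact (baseLocus_transverse_iff hj L x).1 (h x hx) hL

end Duality

/-! ### The derivative of the one-jet of a pencil -/

section Eliminant

variable {N : ℕ}

/-- The linear form in the span of `b` and `c` that vanishes at `z`. -/
def eliminant (b c z : Fin (N + 1) → ℂ) : Fin (N + 1) → ℂ := (c ⬝ᵥ z) • b - (b ⬝ᵥ z) • c

theorem eliminant_dotProduct (b c z w : Fin (N + 1) → ℂ) :
    eliminant b c z ⬝ᵥ w = (c ⬝ᵥ z) * (b ⬝ᵥ w) - (b ⬝ᵥ z) * (c ⬝ᵥ w) := by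
  simp [eliminant, sub_dotProduct]

theorem eliminant_dotProduct_self (b c z : Fin (N + 1) → ℂ) : eliminant b c z ⬝ᵥ z = 0 := by
  rw [eliminant_dotProduct]
  ring

theorem eliminant_dotProduct_eq_zero {b c z w : Fin (N + 1) → ℂ} {t : ℂ}
    (hb : b ⬝ᵥ w = t * (b ⬝ᵥ z)) (hc : c ⬝ᵥ w = t * (c ⬝ᵥ z)) : eliminant b c z ⬝ᵥ w = 0 := by
  rw [eliminant_dotProduct, hb, hc]
  ring

theorem eliminant_eq_smul {b c z w : Fin (N + 1) → ℂ} {t : ℂ} (hb : b ⬝ᵥ w = t * (b ⬝ᵥ z))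
    (hc : c ⬝ᵥ w = t * (c ⬝ᵥ z)) : eliminant b c w = t • eliminant b c z := by
  rw [eliminant, eliminant, hb, hc, smul_sub, mul_smul, mul_smul]

/-- `z ↦ eliminant b c z` as a linear map. -/
def eliminantL (b c : Fin (N + 1) → ℂ) : (Fin (N + 1) → ℂ) →L[ℂ] (Fin (N + 1) → ℂ) :=
  LinearMap.toContinuousLinearMap
    ((dotProductBilin ℂ ℂ c).smulRight b - (dotProductBilin ℂ ℂ b).smulRight c)

variable {E : Type*} [NormedAddCommGroup E] [NormedSpace ℝ E]

/-- The numerator of the quotient rule is the form of the pencil that vanishes at `z`, evaluated on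
`dz`. -/
theorem hasFDerivAt_div {b c : Fin (N + 1) → ℂ} {z : E → Fin (N + 1) → ℂ} {u : E}
    (hz : DifferentiableAt ℝ z u) (hc : c ⬝ᵥ z u ≠ 0) :
    ∃ D : E →L[ℝ] ℂ, HasFDerivAt (fun u => (b ⬝ᵥ z u) / (c ⬝ᵥ z u)) D u ∧
      ∀ v, D v = (eliminant b c (z u) ⬝ᵥ fderiv ℝ z u v) * ((c ⬝ᵥ z u) ^ 2)⁻¹ := by
  obtain ⟨D₁, h₁, hD₁⟩ := (hasFDerivAt_const b u).dotProduct_apply hz.hasFDerivAt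
  obtain ⟨D₂, h₂, hD₂⟩ := (hasFDerivAt_const c u).dotProduct_apply hz.hasFDerivAt
  have h₃ := h₁.mul (((hasFDerivAt_inv hc).restrictScalars ℝ).comp u h₂)
  refine ⟨_, h₃.congr_of_eventuallyEq (.of_forall fun v => div_eq_mul_inv _ _), fun v => ?_⟩
  simp [hD₁, hD₂, eliminant_dotProduct]
  field_simp
  ring

/-- If the differential of the one-jet of a pencil vanishes on a vector `v` of the CR distribution,
then the differential of the conormal is radial on `v`. -/
theorem exists_fderiv_conormal_eq_smul {m : ℕ} {z a : E → Fin (N + 1) → ℂ}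
    {W : Fin m → E → Fin (N + 1) → ℂ} {u v : E} {b c : Fin (N + 1) → ℂ} {t : ℂ}
    (hz : DifferentiableAt ℝ z u) (ha : DifferentiableAt ℝ a u)
    (hW : ∀ i, DifferentiableAt ℝ (W i) u)
    (haz : ∀ᶠ u in 𝓝 u, a u ⬝ᵥ z u = 0) (haW : ∀ i, ∀ᶠ u in 𝓝 u, a u ⬝ᵥ W i u = 0)
    (hspan : ∀ g, g ⬝ᵥ z u = 0 → (∀ i, g ⬝ᵥ W i u = 0) → ∃ r : ℂ, g = r • a u)
    (hne : eliminant b c (z u) ≠ 0) (hfW : ∀ i, eliminant b c (z u) ⬝ᵥ W i u = 0)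
    (hv : a u ⬝ᵥ fderiv ℝ z u v = 0)
    (hb : b ⬝ᵥ fderiv ℝ z u v = t * (b ⬝ᵥ z u)) (hc : c ⬝ᵥ fderiv ℝ z u v = t * (c ⬝ᵥ z u))
    (h : ∀ i, fderiv ℝ (fun u => eliminant b c (z u) ⬝ᵥ W i u) u v = 0) :
    ∃ r : ℂ, fderiv ℝ a u v = r • a u := by
  obtain ⟨r, hr⟩ := hspan _ (eliminant_dotProduct_self b c (z u)) hfW
  have hr0 : r ≠ 0 := by
    rintro rfl
    exact hne (by rw [hr, zero_smul])
  refine hspan _ ?_ fun i => ?_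
  · have h1 := dotProduct_fderiv_add_eq_zero ha hz haz v
    rwa [hv, zero_add] at h1
  · have hf : HasFDerivAt (fun u => eliminant b c (z u))
        (((eliminantL b c).restrictScalars ℝ).comp (fderiv ℝ z u)) u :=
      ((eliminantL b c).restrictScalars ℝ).hasFDerivAt.comp u hz.hasFDerivAt
    obtain ⟨D, hD, hDv⟩ := hf.dotProduct_apply (hW i).hasFDerivAt
    have h1 := h i
    rw [hD.fderiv, hDv] at h1
    -- `b` and `c` cannot tell `dz(v)` from `t z`, so the eliminant only gets rescaled along `v` and
    -- its derivative still kills `W i`.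
    have h2 : (((eliminantL b c).restrictScalars ℝ).comp (fderiv ℝ z u)) v =
        t • eliminant b c (z u) := eliminant_eq_smul hb hc
    rw [h2, smul_dotProduct, hfW, smul_zero, add_zero, hr, smul_dotProduct, smul_eq_mul,
      mul_eq_zero] at h1
    have h3 := dotProduct_fderiv_add_eq_zero ha (hW i) (haW i) v
    rwa [h1.resolve_left hr0, zero_add] at h3

end Eliminant

/-! ### Local frames of the CR distribution -/

section Frames

/-- The kernel of `CP.dproj z` is `ℂz`. Independence of tangent vectors at moving points becomes an
open condition in the fixed space `ℂᴺ⁺¹`. -/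
theorem linearIndependent_cons_iff_dproj {N k : ℕ} {z : Fin (N + 1) → ℂ} (hz : z ≠ 0)
    {w : Fin k → Fin (N + 1) → ℂ} :
    LinearIndependent ℂ (Fin.cons z w : Fin (k + 1) → Fin (N + 1) → ℂ) ↔
      LinearIndependent ℂ fun i => CP.dproj z (w i) := by
  rw [linearIndependent_finCons]
  constructor
  · rintro ⟨h1, h2⟩
    refine h1.map (f := (CP.dproj z : (Fin (N + 1) → ℂ) →ₗ[ℂ] (Fin N → ℂ))) ?_
    rw [CP.ker_dproj hz]
    exact (Submodule.disjoint_span_singleton' hz).2 h2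
  · intro h
    refine ⟨LinearIndependent.of_comp (CP.dproj z : (Fin (N + 1) → ℂ) →ₗ[ℂ] (Fin N → ℂ)) h,
      fun hmem => ?_⟩
    obtain ⟨c, hc⟩ := (Submodule.mem_span_range_iff_exists_fun ℂ).1 hmem
    have h1 : CP.dproj z z = 0 := (CP.dproj_eq_zero_iff hz).2 ⟨1, one_smul _ _⟩
    have h2 : ∑ i, c i • CP.dproj z (w i) = 0 := by
      rw [← h1]
      refine Eq.trans ?_ (congrArg (CP.dproj z) hc)
      simp [map_sum]
    have h3 := Fintype.linearIndependent_iff.1 h c h2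
    exact hz (by rw [← hc]; simp [h3])

variable {n : ℕ} {M : Type*} [TopologicalSpace M]
  [ChartedSpace (EuclideanSpace ℝ (Fin (2 * n + 1))) M] [IsManifold (𝓡 (2 * n + 1)) 1 M]

/-- The vector field on `M` that is `e` in the chart at `x`. -/
def chartField (x : M) (e : EuclideanSpace ℝ (Fin (2 * n + 1)) → EuclideanSpace ℝ (Fin (2 * n + 1)))
    (p : M) : EuclideanSpace ℝ (Fin (2 * n + 1)) := (dchartM n x p).inverse (e (chartM n x p))

theorem dchartM_chartField {x p : M} (hp : p ∈ (chartM n x).source)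
    (e : EuclideanSpace ℝ (Fin (2 * n + 1)) → EuclideanSpace ℝ (Fin (2 * n + 1))) :
    dchartM n x p (chartField x e p) = e (chartM n x p) :=
  (isInvertible_dchartM hp).self_apply_inverse _

/-- The trivialization of the tangent bundle at `x` is the differential of the chart, in which the
field is `e`. -/
theorem contMDiffAt_chartField {x : M}
    {e : EuclideanSpace ℝ (Fin (2 * n + 1)) → EuclideanSpace ℝ (Fin (2 * n + 1))}
    [IsManifold (𝓡 (2 * n + 1)) 2 M] (he : ContDiffAt ℝ 1 e (chartM n x x)) :
    ContMDiffAt (𝓡 (2 * n + 1)) (𝓡 (2 * n + 1)).tangent 1 (fun p =>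
      (⟨p, chartField x e p⟩ : TangentBundle (𝓡 (2 * n + 1)) M)) x := by
  refine (Bundle.contMDiffAt_section x).2 ?_
  have h1 : ContMDiffAt (𝓡 (2 * n + 1)) 𝓘(ℝ, EuclideanSpace ℝ (Fin (2 * n + 1))) 1
      (fun p => e (chartM n x p)) x :=
    ContMDiffAt.comp x he.contMDiffAt (contMDiffAt_extChartAt (n := 1))
  refine h1.congr_of_eventuallyEq ?_
  filter_upwards [extChartAt_source_mem_nhds (I := 𝓡 (2 * n + 1)) x] with p hp
  have hp' : p ∈ (chartAt (EuclideanSpace ℝ (Fin (2 * n + 1))) x).source := by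
    rwa [extChartAt_source] at hp
  rw [← dchartM_chartField hp e]
  have h2 := TangentBundle.continuousLinearMapAt_trivializationAt (I := 𝓡 (2 * n + 1)) hp'
  have h3 := DFunLike.congr_fun h2 (chartField x e p)
  have h4 : ∀ v : TangentSpace (𝓡 (2 * n + 1)) p,
      (trivializationAt (EuclideanSpace ℝ (Fin (2 * n + 1))) (TangentSpace (𝓡 (2 * n + 1))) x
        ⟨p, v⟩).2 = (trivializationAt (EuclideanSpace ℝ (Fin (2 * n + 1)))
          (TangentSpace (𝓡 (2 * n + 1))) x).continuousLinearMapAt ℝ p v := fun v => by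
    rw [Bundle.Trivialization.continuousLinearMapAt_apply,
      Bundle.Trivialization.coe_linearMapAt_of_mem]
    simpa using hp'
  exact (h4 _).trans h3

end Frames

/-! ### Transversality of the one-jets of a pencil -/

section JetTransversality

variable {n : ℕ} {M : Type*} [TopologicalSpace M]
  [ChartedSpace (EuclideanSpace ℝ (Fin (2 * n + 1))) M] {j : M → CP (n + 1)}
  [IsManifold (𝓡 (2 * n + 1)) 1 M] {x : M}
  {z a : EuclideanSpace ℝ (Fin (2 * n + 1)) → Fin (n + 2) → ℂ}
  {b : EuclideanSpace ℝ (Fin (2 * n + 1)) →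
      (Fin (n + 2) → ℂ) →L[ℝ] EuclideanSpace ℝ (Fin (2 * n + 1))}

theorem IsLocalLift.dmap_chartField {p : M} (h : IsLocalLift j x z a b p)
    {W : EuclideanSpace ℝ (Fin (2 * n + 1)) → Fin (n + 2) → ℂ}
    (hW : a (chartM n x p) ⬝ᵥ W (chartM n x p) = 0) :
    dmap (EuclideanSpace ℝ (Fin (2 * n + 1))) j p (chartField x (fun u => b u (W u)) p) =
      CP.dproj (z (chartM n x p)) (W (chartM n x p)) := by
  rw [h.dmap_eq, dchartM_chartField h.mem_source]
  exact (h.dproj_eq_of_re (by rw [hW, Complex.zero_re])).symm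

/-- The CR distribution has `C¹` complex local frames. -/
theorem exists_isComplexFrameAt [IsManifold (𝓡 (2 * n + 1)) 2 M] (hj : IsC2Embedding j)
    (hz : ContDiffAt ℝ 2 z (chartM n x x)) (ha : ContDiffAt ℝ 1 a (chartM n x x))
    (hb : ContDiffAt ℝ 1 b (chartM n x x)) (hev : ∀ᶠ p in 𝓝 x, IsLocalLift j x z a b p) :
    ∃ W : Fin n → EuclideanSpace ℝ (Fin (2 * n + 1)) → Fin (n + 2) → ℂ,
      (∀ i, ContDiffAt ℝ 1 (W i) (chartM n x x)) ∧
      (∀ᶠ p in 𝓝 x, ∀ i, a (chartM n x p) ⬝ᵥ W i (chartM n x p) = 0) ∧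
      crTangent j x = Submodule.span ℂ
        (Set.range fun i => CP.dproj (z (chartM n x x)) (W i (chartM n x x))) ∧
      IsComplexFrameAt j (crDistribution j) x fun i => chartField x fun u => b u (W i u) := by
  have h := hev.self_of_nhds
  let B := Module.finBasisOfFinrankEq ℂ (crTangent j x) (finrank_crTangent hj x)
  choose w hw using fun i => CP.surjective_dproj h.ne_zero (B i : Fin (n + 1) → ℂ)
  have hw0 : ∀ i, a (chartM n x x) ⬝ᵥ w i = 0 := fun i => by
    rw [← h.dproj_mem_crTangent_iff, hw]
    exact (B i).2
  obtain ⟨k, hk⟩ := Function.ne_iff.1 h.dual_ne_zero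
  -- Project `w i` to the kernel of `a u` along a coordinate axis on which `a` does not vanish; at
  -- `x` the correction is zero.
  let W : Fin n → EuclideanSpace ℝ (Fin (2 * n + 1)) → Fin (n + 2) → ℂ := fun i u =>
    w i - ((a u ⬝ᵥ w i) * (a u k)⁻¹) • Pi.single k 1
  have hak : ContDiffAt ℝ 1 (fun u => a u k) (chartM n x x) := contDiffAt_pi.1 ha k
  have hW : ∀ i, ContDiffAt ℝ 1 (W i) (chartM n x x) := fun i =>
    contDiffAt_const.sub (((ha.dotProduct contDiffAt_const).mul (hak.inv hk)).smul contDiffAt_const)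
  have hWx : ∀ i, W i (chartM n x x) = w i := fun i => by
    simp only [W]
    rw [hw0, zero_mul, zero_smul, sub_zero]
  have haW : ∀ᶠ p in 𝓝 x, ∀ i, a (chartM n x p) ⬝ᵥ W i (chartM n x p) = 0 := by
    filter_upwards [(continuousAt_extChartAt x).eventually
      (hak.continuousAt.eventually (isOpen_ne.mem_nhds hk))] with p hp i
    have hp' : a (chartM n x p) k ≠ 0 := hp
    simp only [W]
    rw [dotProduct_sub, dotProduct_smul, dotProduct_single_one, smul_eq_mul,
      inv_mul_cancel_right₀ hp', sub_self]
  have hindep : ∀ᶠ p in 𝓝 x, LinearIndependent ℂ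
      fun i => CP.dproj (z (chartM n x p)) (W i (chartM n x p)) := by
    have hc : ContinuousAt (fun p => (Fin.cons (z (chartM n x p)) fun i => W i (chartM n x p) :
        Fin (n + 1) → Fin (n + 2) → ℂ)) x := by
      refine continuousAt_pi.2 fun i => Fin.cases ?_ (fun i => ?_) i
      · exact hz.continuousAt.comp (continuousAt_extChartAt x)
      · exact (hW i).continuousAt.comp (continuousAt_extChartAt x)
    have h0 : LinearIndependent ℂ (Fin.cons (z (chartM n x x)) fun i => W i (chartM n x x) :
        Fin (n + 1) → Fin (n + 2) → ℂ) := by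
      rw [linearIndependent_cons_iff_dproj h.ne_zero]
      simp only [hWx, hw]
      exact B.linearIndependent.map' (crTangent j x).subtype (Submodule.ker_subtype _)
    filter_upwards [hc.eventually (isOpen_setOfPred_linearIndependent.mem_nhds h0), hev] with p hp hpl
    exact (linearIndependent_cons_iff_dproj hpl.ne_zero).1 hp
  have hspan : ∀ᶠ p in 𝓝 x, crTangent j p = Submodule.span ℂ
      (Set.range fun i => CP.dproj (z (chartM n x p)) (W i (chartM n x p))) := by
    filter_upwards [hev, haW, hindep] with p h1 h2 h3
    refine (Submodule.eq_of_le_of_finrank_eq ?_ ?_).symm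
    · rw [Submodule.span_le]
      rintro _ ⟨i, rfl⟩
      exact h1.dproj_mem_crTangent_iff.2 (h2 i)
    · rw [finrank_span_eq_card h3, finrank_crTangent hj, Fintype.card_fin]
  refine ⟨W, hW, haW, hspan.self_of_nhds, fun i => ?_, ?_⟩
  · exact contMDiffAt_chartField (hb.clm_apply (hW i))
  · filter_upwards [hev, haW, hindep, hspan] with p h1 h2 h3 h4
    have h5 := fun i => h1.dmap_chartField (h2 i)
    simp only [h5]
    refine ⟨fun i => ?_, h3, ?_⟩
    · change dmap (EuclideanSpace ℝ (Fin (2 * n + 1))) j p _ ∈ crTangent j p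
      rw [h5, h1.dproj_mem_crTangent_iff]
      exact h2 i
    · rw [map_crDistribution, h4]

theorem extChartAt_CP_one {N : ℕ} (q : CP N) :
    ∃ i, q.rep i ≠ 0 ∧ ∀ p, extChartAt 𝓘(ℝ, Fin N → ℂ) q p = CP.affCoord i p :=
  ⟨_, (CP.exists_rep_ne_zero q).choose_spec, fun _ => rfl⟩

/-- The components of the one-jet of a pencil in a local frame that comes from `W`. -/
theorem jetComponent_eventuallyEq (L : HyperplanePencil (n + 1)) (hx : j x ∉ L.baseLocus)
    (hz : ContDiffAt ℝ 2 z (chartM n x x)) (hev : ∀ᶠ p in 𝓝 x, IsLocalLift j x z a b p)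
    {W : Fin n → EuclideanSpace ℝ (Fin (2 * n + 1)) → Fin (n + 2) → ℂ}
    (haW : ∀ᶠ p in 𝓝 x, ∀ i, a (chartM n x p) ⬝ᵥ W i (chartM n x p) = 0) :
    ∃ i : Fin 2, L.form i ⬝ᵥ z (chartM n x x) ≠ 0 ∧
      ∀ᶠ p in 𝓝 x, jetComponent (L.map ∘ j) x (fun l => chartField x fun u => b u (W l u)) p =
        fun l k => (eliminant (L.form (i.succAbove k)) (L.form i) (z (chartM n x p)) ⬝ᵥ
          W l (chartM n x p)) * ((L.form i ⬝ᵥ z (chartM n x p)) ^ 2)⁻¹ := by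
  have h := hev.self_of_nhds
  have hy : L.evalForms (z (chartM n x x)) ≠ 0 := fun h0 =>
    hx ((L.evalForms_eq_zero_iff_of_proj h.ne_zero h.proj_eq).1 h0)
  obtain ⟨i, hi, hchart⟩ := extChartAt_CP_one ((L.map ∘ j) x)
  have hi' : L.form i ⬝ᵥ z (chartM n x x) ≠ 0 := by
    rw [Function.comp_apply, ← h.proj_eq, L.map_proj h.ne_zero, CP.proj_of_ne hy,
      CP.rep_mk_ne_zero_iff] at hi
    exact hi
  refine ⟨i, hi', ?_⟩
  have hne : ∀ᶠ p in 𝓝 x, L.form i ⬝ᵥ z (chartM n x p) ≠ 0 := by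
    have hc : ContinuousAt (fun u => L.form i ⬝ᵥ z u) (chartM n x x) :=
      ((contDiffAt_const (c := L.form i)).dotProduct (m := 2) hz).continuousAt
    exact (continuousAt_extChartAt x).eventually (hc.eventually (isOpen_ne.mem_nhds hi'))
  have hF : ∀ᶠ p in 𝓝 x, extChartAt 𝓘(ℝ, Fin 1 → ℂ) ((L.map ∘ j) x) ((L.map ∘ j) p) =
      fun k => (L.form (i.succAbove k) ⬝ᵥ z (chartM n x p)) / (L.form i ⬝ᵥ z (chartM n x p)) := by
    filter_upwards [hev, hne] with p hp hpi
    have hyp : L.evalForms (z (chartM n x p)) ≠ 0 := fun h0 => hpi (congrFun h0 i)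
    rw [hchart, Function.comp_apply, ← hp.proj_eq, L.map_proj hp.ne_zero, CP.proj_of_ne hyp,
      CP.affCoord_mk]
    rfl
  filter_upwards [hF.eventually_nhds, hev, haW, hne] with p h1 h2 h3 h4
  choose D hD hDv using fun k => hasFDerivAt_div (b := L.form (i.succAbove k)) h2.differentiableAt h4
  have hD' : HasFDerivAt (fun u k => (L.form (i.succAbove k) ⬝ᵥ z u) / (L.form i ⬝ᵥ z u))
      (ContinuousLinearMap.pi D) (chartM n x p) := hasFDerivAt_pi.2 hD
  have h5 := (hasMFDerivAt_of_chart h2.mem_source hD'.differentiableAt h1).mfderiv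
  funext l k
  have h6 := congrFun (DFunLike.congr_fun h5 (chartField x (fun u => b u (W l u)) p)) k
  refine h6.trans ?_
  rw [hD'.fderiv]
  change D k (dchartM n x p (chartField x (fun u => b u (W l u)) p)) = _
  rw [dchartM_chartField h2.mem_source, hDv]
  -- `W l` and the derivative of `z` along the field differ by a multiple of `z`, which the
  -- eliminant kills.
  obtain ⟨c, hc⟩ := h2.exists_eq_of_re (W l (chartM n x p)) (by rw [h3, Complex.zero_re])
  conv_rhs => rw [hc, dotProduct_add, dotProduct_smul, eliminant_dotProduct_self, smul_zero, add_zero]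

/-- The one-jet of a pencil along the CR distribution is transversal along it to `Σ`, off the base
locus. -/
theorem jetTransverseAt_crDistribution [IsManifold (𝓡 (2 * n + 1)) 2 M] (hj : IsC2Embedding j)
    (hν : HasImmersedDualSet j) (L : HyperplanePencil (n + 1)) (hx : j x ∉ L.baseLocus) :
    JetTransverseAt j (crDistribution j) (L.map ∘ j) x (crDistribution j x) := by
  intro hsing
  obtain ⟨z, a, b, hz, ha, hb, hev⟩ := exists_isLocalLift hj x
  obtain ⟨W, hW, haW, hspan, hframe⟩ := exists_isComplexFrameAt hj hz ha hb hev
  obtain ⟨i, hi, hjet⟩ := jetComponent_eventuallyEq L hx hz hev haW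
  refine ⟨n, _, hframe, ?_⟩
  have h := hev.self_of_nhds
  have haW0 := haW.self_of_nhds
  have ha1 : DifferentiableAt ℝ a (chartM n x x) := ha.differentiableAt (by simp)
  have hW1 : ∀ l, DifferentiableAt ℝ (W l) (chartM n x x) := fun l =>
    (hW l).differentiableAt (by simp)
  have hy : L.evalForms (z (chartM n x x)) ≠ 0 := fun h0 => hi (congrFun h0 i)
  -- Since `dφ` vanishes on `D_x`, the lift of `φ` to `ℂ²` moves only radially along `D_x`.
  have hrad : ∀ v ∈ crDistribution j x, ∃ t : ℂ, ∀ k,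
      L.form k ⬝ᵥ fderiv ℝ z (chartM n x x) (dchartM n x x v) =
        t * (L.form k ⬝ᵥ z (chartM n x x)) := fun v hv => by
    have hyd : HasFDerivAt (fun u => L.evalForms (z u))
        ((L.evalForms.restrictScalars ℝ).comp (fderiv ℝ z (chartM n x x))) (chartM n x x) :=
      (L.evalForms.restrictScalars ℝ).hasFDerivAt.comp (chartM n x x) h.differentiableAt.hasFDerivAt
    have h1 := dmap_of_lift (f := L.map ∘ j) h.mem_source hy hyd.differentiableAt
      (hev.mono fun p hp => by rw [Function.comp_apply, ← hp.proj_eq, L.map_proj hp.ne_zero]) v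
    rw [hsing v hv, hyd.fderiv] at h1
    obtain ⟨t, ht⟩ := (CP.dproj_eq_zero_iff hy).1 h1.symm
    exact ⟨t, fun k => (congrFun ht k).symm⟩
  have hspan' : ∀ g, g ⬝ᵥ z (chartM n x x) = 0 → (∀ l, g ⬝ᵥ W l (chartM n x x) = 0) →
      ∃ r : ℂ, g = r • a (chartM n x x) := fun g hgz hgW => by
    have hg : g ∈ Submodule.span ℂ {a (chartM n x x)} := by
      refine mem_of_annihilator_le fun w hw => ?_
      have hw0 := hw _ (Submodule.mem_span_singleton_self _)
      rw [← h.dproj_mem_crTangent_iff, hspan, Submodule.mem_span_range_iff_exists_fun] at hw0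
      obtain ⟨c, hc⟩ := hw0
      have h1 : CP.dproj (z (chartM n x x)) (w - ∑ l, c l • W l (chartM n x x)) = 0 := by
        rw [map_sub, ← hc, map_sum]
        simp only [map_smul]
        exact sub_self _
      obtain ⟨t, ht⟩ := (CP.dproj_eq_zero_iff h.ne_zero).1 h1
      rw [← sub_add_cancel w (∑ l, c l • W l (chartM n x x)), ← ht, dotProduct_add,
        dotProduct_smul, hgz, smul_zero, zero_add, dotProduct_sum]
      exact Finset.sum_eq_zero fun l _ => by rw [dotProduct_smul, hgW, smul_zero]
    obtain ⟨r, hr⟩ := Submodule.mem_span_singleton.1 hg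
    exact ⟨r, hr.symm⟩
  have hfW : ∀ k l, eliminant (L.form (i.succAbove k)) (L.form i) (z (chartM n x x)) ⬝ᵥ
      W l (chartM n x x) = 0 := fun k l => by
    obtain ⟨c, hc⟩ := h.exists_eq_of_re (W l (chartM n x x)) (by rw [haW0, Complex.zero_re])
    obtain ⟨v, hv⟩ := (isInvertible_dchartM h.mem_source).surjective
      (b (chartM n x x) (W l (chartM n x x)))
    have hvD : v ∈ crDistribution j x := by
      rw [h.mem_crDistribution_iff, hv, eq_sub_of_add_eq hc.symm, dotProduct_sub, haW0,
        dotProduct_smul, h.dotProduct_eq_zero, smul_zero, sub_zero]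
    obtain ⟨t, ht⟩ := hrad v hvD
    rw [hv] at ht
    rw [hc, dotProduct_add, eliminant_dotProduct_eq_zero (ht _) (ht _), dotProduct_smul,
      eliminant_dotProduct_self, smul_zero, zero_add]
  have hne : eliminant (L.form (i.succAbove 0)) (L.form i) (z (chartM n x x)) ≠ 0 := fun h0 => by
    obtain ⟨w, hw⟩ := L.surjective_evalForms (Pi.single (i.succAbove 0) 1)
    have h1 : L.form (i.succAbove 0) ⬝ᵥ w = 1 := by
      rw [← L.evalForms_apply, hw, Pi.single_eq_same]
    have h2 : L.form i ⬝ᵥ w = 0 := by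
      rw [← L.evalForms_apply, hw, Pi.single_eq_of_ne (Fin.succAbove_ne i 0).symm]
    have h3 := eliminant_dotProduct (L.form (i.succAbove 0)) (L.form i) (z (chartM n x x)) w
    rw [h0, zero_dotProduct, h1, h2, mul_one, mul_zero, sub_zero] at h3
    exact hi h3.symm
  have hs : DifferentiableAt ℝ (fun u => ((L.form i ⬝ᵥ z u) ^ 2)⁻¹) (chartM n x x) :=
    (((contDiffAt_const (c := L.form i)).dotProduct hz).pow 2).inv (pow_ne_zero 2 hi)
      |>.differentiableAt (by simp)
  have hq : ∀ k l, DifferentiableAt ℝ (fun u =>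
      eliminant (L.form (i.succAbove k)) (L.form i) (z u) ⬝ᵥ W l u) (chartM n x x) := fun k l =>
    (ContDiffAt.dotProduct (m := 1) (((eliminantL _ _).restrictScalars ℝ).contDiff.contDiffAt.comp _
      (hz.of_le (by norm_num))) (hW l)).differentiableAt (by simp)
  -- The derivative of the denominator does not contribute, as the numerators vanish at the singular
  -- point by `hfW`.
  let G' : EuclideanSpace ℝ (Fin (2 * n + 1)) →L[ℝ] (Fin n → Fin 1 → ℂ) :=
    ContinuousLinearMap.pi fun l => ContinuousLinearMap.pi fun k =>
      (((L.form i ⬝ᵥ z (chartM n x x)) ^ 2)⁻¹ : ℂ) • fderiv ℝ (fun u =>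
        eliminant (L.form (i.succAbove k)) (L.form i) (z u) ⬝ᵥ W l u) (chartM n x x)
  have hG : HasFDerivAt (fun u l k =>
      (eliminant (L.form (i.succAbove k)) (L.form i) (z u) ⬝ᵥ W l u) *
        ((L.form i ⬝ᵥ z u) ^ 2)⁻¹) G' (chartM n x x) := by
    refine hasFDerivAt_pi.2 fun l => hasFDerivAt_pi.2 fun k => ?_
    refine ((hq k l).hasFDerivAt.mul hs.hasFDerivAt).congr_fderiv ?_
    refine ContinuousLinearMap.ext fun v => ?_
    rw [hfW]
    simp
  have hjet' : ∀ v, (mfderiv (𝓡 (2 * n + 1)) 𝓘(ℝ, Fin n → Fin 1 → ℂ) (jetComponent (L.map ∘ j) x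
      fun l => chartField x fun u => b u (W l u)) x :
        EuclideanSpace ℝ (Fin (2 * n + 1)) →L[ℝ] (Fin n → Fin 1 → ℂ)) v =
      G' (dchartM n x x v) := fun v => by
    have h1 := (hasMFDerivAt_of_chart h.mem_source hG.differentiableAt hjet).mfderiv
    rw [hG.fderiv] at h1
    exact DFunLike.congr_fun h1 v
  have hinj : Function.Injective ((G'.comp (dchartM n x x)).toLinearMap.domRestrict
      (crDistribution j x)) := by
    rw [← LinearMap.ker_eq_bot, LinearMap.ker_eq_bot']
    rintro ⟨v, hv⟩ hGv
    obtain ⟨t, ht⟩ := hrad v hv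
    obtain ⟨r, hr⟩ := exists_fderiv_conormal_eq_smul h.differentiableAt ha1 hW1
      (eventually_of_eventually_chartM (hev.mono fun _ hp => hp.dotProduct_eq_zero))
      (fun l => eventually_of_eventually_chartM
        (Q := fun u => a u ⬝ᵥ W l u = 0) (haW.mono fun _ hp => hp l)) hspan' hne (hfW 0)
      (h.mem_crDistribution_iff.1 hv) (ht _) (ht _) (fun l => by
        have h1 := congrFun (congrFun hGv l) 0
        exact (mul_eq_zero.1 h1).resolve_left (inv_ne_zero (pow_ne_zero 2 hi)))
    have h2 := dmap_dualMap_eq hj ha1 hev v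
    rw [hr, (CP.dproj_eq_zero_iff h.dual_ne_zero (v := r • a (chartM n x x))).2 ⟨r, rfl⟩] at h2
    exact Subtype.ext (hν x (h2.trans (map_zero (dmap _ (dualMap j) x)).symm))
  -- Both sides are `2n`; injectivity thus upgrades to surjectivity onto the fibre of jets.
  have hdim : Module.finrank ℝ (crDistribution j x) =
      Module.finrank ℝ (Fin n → Fin 1 → ℂ) := by
    rw [finrank_crDistribution hj, finrank_real_of_complex, Module.finrank_pi_fintype]
    simp
  have hsurj := (LinearMap.injective_iff_surjective_of_finrank_eq_finrank hdim).1 hinj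
  refine sup_tangentSigma_eq_of_surjOn _ _ _ fun η => ?_
  obtain ⟨⟨v, hv⟩, hvη⟩ := hsurj η
  exact ⟨v, hv, (hjet' v).trans hvη⟩

/-- Vacuous: `Φ` is a submersion off the base locus, so its full one-jet never meets `Σ`. -/
theorem jetTransverseAt_envelope {N : ℕ} (L : HyperplanePencil N) {p : CP N}
    (hp : p ∉ L.baseLocus) (A : Submodule ℝ (Fin N → ℂ)) :
    JetTransverseAt (id : CP N → CP N) (fun _ => ⊤) L.map p A := by
  intro h
  obtain ⟨v, hv⟩ := L.surjective_dmap_map hp 1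
  rw [h v trivial] at hv
  exact absurd hv zero_ne_one

end JetTransversality

end

theorem mainTheorem10 {n : ℕ} {M : Type*} [TopologicalSpace M]
    [ChartedSpace (EuclideanSpace ℝ (Fin (2 * n + 1))) M] [IsManifold (𝓡 (2 * n + 1)) 2 M]
    (j : M → CP (n + 1)) (hj : IsC2Embedding j) (hν : HasImmersedDualSet j)
    (L : HyperplanePencil (n + 1)) :
    (IsLefschetzPencil j L ↔ BaseLocusTransverse j L) ∧
      (DefinesLefschetzPencilStructure j L ↔ BaseLocusTransverse j L) := by
  refine ⟨isLefschetzPencil_iff hj hν L, fun h => h.base_transverse, fun h => ?_⟩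
  exact ⟨fun H hH H' hH' hne => L.hyperplanes_transverse hH hH' hne, h,
    fun x hx => jetTransverseAt_crDistribution hj hν L hx,
    fun x hx => jetTransverseAt_envelope L hx _⟩
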